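/- All graphs are finite, simple and undirected. For a graph $G$ of order $n$ with adjacency eigenvalues $\lambda_1,\dots,\lambda_n$ let $S_j(G)=\sum_{i=1}^n\lambda_i^j$ ($0\le j\le n-1$) be its spectral moments. For two graphs $G_1,G_2$ of order $n$ write $G_1\prec_S G_2$ ("$G_1$ comes before $G_2$ in the $S$-order") if there is an integer $1\le j\le n-1$ such that $S_i(G_1)=S_i(G_2)$ for all $i<j$ and $S_j(G_1)<S_j(G_2)$. Let $m,n$ be positive integers with $n-1\le m\le\binom n2$, and let $\mathscr G_{m,n}$ be the set of connected graphs with $m$ edges and $n$ vertices. A graph $G\in\mathscr G_{m,n}$ is called a last graph in the $S$-order over $\mathscr G_{m,n}$ if $G\prec_S H$ holds for no $H\in\mathscr G_{m,n}$. Let $r=r_{m,n}$ and $t=t_{m,n}$ be the positive integers (they exist and are unique) with $$m-n=\binom{r-1}{2}+t-2,$$ where $2\le t\le r$ if $m\ge n$, and $t=r=1$ if $m=n-1$. Let $K_r^t$ be the graph obtained by joining a new vertex to $t$ vertices of a complete graph $K_r$. **Theorem.** There is a graph obtained from $K_r^t$ by adding $n-r-1$ pendant edges to a vertex of degree $r$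 (in particular $r+1\le n$), and every such graph is a last graph in the $S$-order over $\mathscr G_{m,n}$. If $(m,n)\ne(3,4)$, then conversely every last graph in the $S$-order over $\mathscr G_{m,n}$ is obtained in this way, and the last graph is unique up to isomorphism: every graph in $\mathscr G_{m,n}$ is isomorphic to it or comes before it in the $S$-order. -/

import Mathlib

namespace SOrder

open Classical in
/-- The adjacency matrix of a finite simple graph over the reals is Hermitian. -/
theorem adjMatrix_isHermitian {V : Type*} [Fintype V] (G : SimpleGraph V) :
    (G.adjMatrix ℝ).IsHermitian := by
  rw [Matrix.IsHermitian, Matrix.conjTranspose_eq_transpose_of_trivial]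
  exact G.isSymm_adjMatrix

open Classical in
/-- The `j`-th spectral moment of a finite simple graph: the sum of the `j`-th powers of the
eigenvalues (with multiplicity) of its adjacency matrix. -/
noncomputable def spectralMoment {V : Type*} [Fintype V] (G : SimpleGraph V) (j : ℕ) : ℝ :=
  ∑ i, (adjMatrix_isHermitian G).eigenvalues i ^ j

/-- `G` comes before `H` in the `S`-order (graphs of order `n`): at some position
`j` with `1 ≤ j ≤ n - 1` the `j`-th moment of `G` is smaller than that of `H`, and all
moments at smaller positions agree. -/
def SBefore {n : ℕ} (G H : SimpleGraph (Fin n)) : Prop :=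
  ∃ j : ℕ, 1 ≤ j ∧ j ≤ n - 1 ∧
    (∀ i < j, spectralMoment G i = spectralMoment H i) ∧
    spectralMoment G j < spectralMoment H j

/-- The class of connected graphs with `m` edges and `n` vertices. -/
def connectedGraphs (m n : ℕ) : Set (SimpleGraph (Fin n)) :=
  {G | G.Connected ∧ G.edgeSet.ncard = m}

/-- `G` is a last graph in the `S`-order over the connected graphs with `m` edges and `n`
vertices: it belongs to this class and does not come before any member of it. -/
def IsLast (m n : ℕ) (G : SimpleGraph (Fin n)) : Prop :=
  G ∈ connectedGraphs m n ∧ ∀ H ∈ connectedGraphs m n, ¬ SBefore G H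

/-- The relation defining `r = r_{m,n}` and `t = t_{m,n}`: both are positive integers,
`m - n = C(r-1, 2) + t - 2`, where `2 ≤ t ≤ r` if `m ≥ n`, and `t = r = 1` if `m = n - 1`. -/
def IsParams (m n r t : ℕ) : Prop :=
  1 ≤ r ∧ 1 ≤ t ∧
    (m : ℤ) - (n : ℤ) = ((r - 1).choose 2 : ℤ) + (t : ℤ) - 2 ∧
    (n ≤ m → 2 ≤ t ∧ t ≤ r) ∧
    (m + 1 = n → t = 1 ∧ r = 1)

/-- Existence of `r_{m,n}` and `t_{m,n}`. -/
theorem exists_isParams {m n : ℕ} (h : n ≤ m + 1) : ∃ r t : ℕ, IsParams m n r t := by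
  have key : ∀ k : ℕ, ∃ r t : ℕ, 2 ≤ t ∧ t ≤ r ∧ (r - 1).choose 2 + t = k + 2 := by
    intro k
    induction k with
    | zero => exact ⟨2, 2, le_rfl, le_rfl, by decide⟩
    | succ k ih =>
      obtain ⟨r, t, h2, htr, he⟩ := ih
      rcases htr.lt_or_eq with hlt | heq
      · exact ⟨r, t + 1, by omega, hlt, by omega⟩
      · refine ⟨r + 1, 2, le_rfl, by omega, ?_⟩
        obtain ⟨q, rfl⟩ : ∃ q, r = q + 1 := ⟨r - 1, by omega⟩
        have e := Nat.choose_succ_succ q 1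
        simp only [Nat.choose_one_right, Nat.succ_eq_add_one, Nat.reduceAdd] at e
        simp only [Nat.add_sub_cancel] at he ⊢
        omega
  by_cases hmn : n ≤ m
  · obtain ⟨r, t, h2, htr, he⟩ := key (m - n)
    exact ⟨r, t, by omega, by omega, by omega, fun _ => ⟨h2, htr⟩, fun h' => by omega⟩
  · refine ⟨1, 1, le_rfl, le_rfl, ?_, fun h' => absurd h' hmn, fun _ => ⟨rfl, rfl⟩⟩
    simp
    omega

/-- Uniqueness of `r_{m,n}` and `t_{m,n}`. -/
theorem IsParams.unique {m n r t r' t' : ℕ} (hmn : n ≤ m + 1) (h : IsParams m n r t)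
    (h' : IsParams m n r' t') : r = r' ∧ t = t' := by
  have mono : ∀ a b : ℕ, 1 ≤ a → a < b → (a - 1).choose 2 + (a - 1) ≤ (b - 1).choose 2 := by
    intro a b ha hab
    obtain ⟨q, rfl⟩ : ∃ q, a = q + 1 := ⟨a - 1, by omega⟩
    have e := Nat.choose_succ_succ q 1
    simp only [Nat.choose_one_right, Nat.succ_eq_add_one, Nat.reduceAdd] at e
    have l := Nat.choose_le_choose 2 (show q + 1 ≤ b - 1 by omega)
    simp only [Nat.add_sub_cancel]
    omega
  obtain ⟨hr, ht, he, hg, htree⟩ := h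
  obtain ⟨hr', ht', he', hg', htree'⟩ := h'
  by_cases hc : n ≤ m
  · have g := hg hc
    have g' := hg' hc
    rcases lt_trichotomy r r' with hlt | heq | hgt
    · have := mono r r' hr hlt
      omega
    · subst heq
      omega
    · have := mono r' r hr' hgt
      omega
  · have g := htree (by omega)
    have g' := htree' (by omega)
    omega

/-- The graph `K_r^t`: a new vertex `none` is joined to `t` vertices of a copy of `K_r`
(for `t ≤ r`). -/
def cliqueJoin (r t : ℕ) : SimpleGraph (Option (Fin r)) where
  Adj
    | some i, some j => i ≠ j
    | some i, none => i.val < t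
    | none, some j => j.val < t
    | none, none => False
  symm := ⟨by
    rintro (_ | i) (_ | j) h
    · exact h
    · exact h
    · exact h
    · exact Ne.symm h⟩
  loopless := ⟨by
    rintro (_ | i) h
    · exact h
    · exact h rfl⟩

/-- The graph obtained from `G` by adding `p` pendant edges to the vertex `v`. -/
def addPendant {V : Type*} (G : SimpleGraph V) (v : V) (p : ℕ) : SimpleGraph (V ⊕ Fin p) where
  Adj
    | .inl a, .inl b => G.Adj a b
    | .inl a, .inr _ => a = v
    | .inr _, .inl b => b = v
    | .inr _, .inr _ => False
  symm := ⟨by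
    rintro (a | i) (b | j) h
    · exact SimpleGraph.Adj.symm (G := G) h
    · exact h
    · exact h
    · exact h⟩
  loopless := ⟨by
    rintro (a | i) h
    · exact G.loopless.irrefl a h
    · exact h⟩

open Classical in
/-- `G` is (isomorphic to) a graph obtained from `K_r^t` by adding `n - r - 1` pendant edges to
a vertex of degree `r`. As `G` has `n` vertices, the isomorphism forces `r + 1 ≤ n`. -/
def IsCliqueWithPendants (n r t : ℕ) (G : SimpleGraph (Fin n)) : Prop :=
  ∃ v : Option (Fin r), (cliqueJoin r t).degree v = r ∧
    Nonempty (G ≃g addPendant (cliqueJoin r t) v (n - r - 1))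

end SOrder

/-! On connected graphs with m edges and n vertices the moments S_0, S_1, S_2 are constant (n, 0,
2m). So the S-order first compares S_3, six times the number of triangles, and then S_4, the number
of closed 4-walks. It turns out that these two already single out one graph up to isomorphism. Put c
= m - n + 1 = C(q,2) + s with 0 ≤ s ≤ q, so that r = q + 1 and t = s + 1 in the notation of the
theorem.

The triangle bound is C(q+1,3) + C(s+1,2), encoded by `triMax`. It is proved by induction on the
vertex set in `triangleBound`. If there is no cut vertex, delete a vertex of minimum degree d: this
lowers c by d - 1 and destroys at most C(d,2) triangles, and `triMax_step` says that the bound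
allows this. Equality forces a clique on q + 1 vertices, and an edge count (`card_of_clique`) leaves
only one vertex outside it, so the graph is K_r^t. If there is a cut vertex, the graph is two
connected pieces glued at it; c and the triangle number are additive, and `triMax` is superadditive
(`triMax_add`).

Equality while gluing occurs only if one piece is a tree, or if one piece has c = 1 and the other c
= C(q,2). Here S_4 decides: gluing adds four times the product of the degrees of x in the two pieces
(`walks4_glue`). This is largest when x is adjacent to everything, which for a tree means hanging
pendant edges on a dominating vertex; in the second case S_4 is always too small.

The S-order uses only moments of index at most n - 1, so S_4 is available only for n ≥ 5. This is
why `TriangleBound` records that a graph losing only in S_4 has at least four vertices, and is a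
tree if it has exactly four. That leaves (m,n) = (3,4) as the only exception: the path and the star
agree in S_0, ..., S_3. -/

namespace SOrder

/-! ### Arithmetic of the triangle bound -/

/-- `c = C(q, 2) + s` with `0 ≤ s ≤ q`. -/
def Cascade (c q s : ℤ) : Prop := 0 ≤ s ∧ s ≤ q ∧ 2 * c = q * (q - 1) + 2 * s

/-- Six times `C(q + 1, 3) + C(s + 1, 2)`. -/
def cascadeValue (q s : ℤ) : ℤ := (q + 1) * q * (q - 1) + 3 * (s * (s + 1))

/-- C(q,2) + q = C(q+1,2) + 0 is the only ambiguity of the representation. -/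
theorem Cascade.lt_or {c q s q' s' : ℤ} (h : Cascade c q s) (h' : Cascade c q' s')
    (hlt : q < q') : s = q ∧ q' = q + 1 ∧ s' = 0 := by
  obtain ⟨h0, h1, h2⟩ := h
  obtain ⟨h0', h1', h2'⟩ := h'
  have hq : 0 ≤ q := by omega
  have hq' : q' = q + 1 := by
    by_contra hne
    have : q + 2 ≤ q' := by omega
    nlinarith
  subst hq'
  have : s = q + s' := by linarith
  omega

/-- For the ambiguous pair, C(q+1,3) + C(q+1,2) = C(q+2,3). Hence the value depends on c alone and
the choice in `triMax` is harmless. -/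
theorem Cascade.value_unique {c q s q' s' : ℤ} (h : Cascade c q s) (h' : Cascade c q' s') :
    cascadeValue q s = cascadeValue q' s' := by
  rcases lt_trichotomy q q' with hlt | heq | hgt
  · obtain ⟨rfl, rfl, rfl⟩ := h.lt_or h' hlt
    simp only [cascadeValue]; ring
  · subst heq
    have : s = s' := by have := h.2.2; have := h'.2.2; linarith
    rw [this]
  · obtain ⟨rfl, rfl, rfl⟩ := h'.lt_or h hgt
    simp only [cascadeValue]; ring

theorem Cascade.unique_of_pos {c q s q' s' : ℤ} (h : Cascade c q s) (h' : Cascade c q' s')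
    (hs : 0 < s) (hs' : 0 < s') : q = q' ∧ s = s' := by
  rcases lt_trichotomy q q' with hlt | heq | hgt
  · have := h.lt_or h' hlt; omega
  · subst heq
    exact ⟨rfl, by have := h.2.2; have := h'.2.2; linarith⟩
  · have := h'.lt_or h hgt; omega

theorem exists_cascade_pos (k : ℕ) : ∃ q s : ℤ, 1 ≤ s ∧ Cascade (k + 1) q s := by
  induction k with
  | zero => exact ⟨1, 1, by norm_num, by norm_num [Cascade]⟩
  | succ k ih =>
    obtain ⟨q, s, hs, h0, h1, h2⟩ := ih
    rcases h1.lt_or_eq with hlt | heq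
    · exact ⟨q, s + 1, by omega, by omega, by omega, by push_cast; linarith⟩
    · exact ⟨q + 1, 1, by omega, by omega, by omega, by push_cast; subst heq; linarith⟩

theorem exists_cascade_of_one_le {c : ℤ} (hc : 1 ≤ c) : ∃ q s : ℤ, 1 ≤ s ∧ Cascade c q s := by
  have := exists_cascade_pos (c - 1).toNat
  rwa [Int.toNat_of_nonneg (by omega), sub_add_cancel] at this

theorem cascade_zero : Cascade 0 0 0 := by norm_num [Cascade]

/-- Six times the largest number of triangles in a connected graph of cyclomatic number `c`. -/
noncomputable def triMax (c : ℤ) : ℤ :=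
  Classical.epsilon fun y => ∃ q s : ℤ, Cascade c q s ∧ y = cascadeValue q s

theorem Cascade.triMax_eq {c q s : ℤ} (h : Cascade c q s) : triMax c = cascadeValue q s := by
  have := Classical.epsilon_spec (p := fun y => ∃ q s : ℤ, Cascade c q s ∧ y = cascadeValue q s)
    ⟨_, q, s, h, rfl⟩
  obtain ⟨q', s', h', e⟩ := this
  exact e.trans (h'.value_unique h)

theorem triMax_zero : triMax 0 = 0 := by
  rw [cascade_zero.triMax_eq]; norm_num [cascadeValue]

theorem triMax_one : triMax 1 = 6 := by
  have h : Cascade 1 1 1 := by norm_num [Cascade]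
  rw [h.triMax_eq]; norm_num [cascadeValue]

/-- The numerical side of deleting a vertex of degree d whose neighbours form a clique. If d - 1 ≤
s, the partial row s shrinks and the slack is 6(d - 1)(s + 1 - d). Otherwise the representation
drops to level q - 1 and the slack is 6(q - d)(d - s - 1). The bound on d(d - 1) guarantees d ≤ q in
the second case. -/
theorem triMax_step {c d q s : ℤ} (hd : 2 ≤ d) (hcd : d * (d - 1) ≤ 2 * c)
    (h : Cascade c q s) (hs : 1 ≤ s) :
    triMax (c - (d - 1)) + 3 * (d * (d - 1)) ≤ triMax c ∧
      (triMax (c - (d - 1)) + 3 * (d * (d - 1)) = triMax c → d = s + 1 ∨ d = q ∧ s + 1 < q) := by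
  have hv := h.triMax_eq
  obtain ⟨h0, h1, h2⟩ := h
  rcases le_or_gt (d - 1) s with hds | hds
  · have h' : Cascade (c - (d - 1)) q (s - (d - 1)) := ⟨by omega, by omega, by linarith⟩
    rw [hv, h'.triMax_eq]
    simp only [cascadeValue]
    constructor
    · nlinarith
    · intro he
      left
      have : (s + 1 - d) * (d - 1) = 0 := by nlinarith
      rcases mul_eq_zero.1 this with h | h <;> omega
  · have hdq : d ≤ q := by
      by_contra hlt
      have : q + 1 ≤ d := by omega
      nlinarith
    have h' : Cascade (c - (d - 1)) (q - 1) (q - 1 + s - (d - 1)) :=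
      ⟨by omega, by omega, by linarith⟩
    rw [hv, h'.triMax_eq]
    simp only [cascadeValue]
    have key : ((q + 1) * q * (q - 1) + 3 * (s * (s + 1))) -
      ((q - 1 + 1) * (q - 1) * (q - 1 - 1) + 3 * ((q - 1 + s - (d - 1)) *
        (q - 1 + s - (d - 1) + 1)) + 3 * (d * (d - 1))) = 6 * ((q - d) * (d - s - 1)) := by ring
    have nn : 0 ≤ (q - d) * (d - s - 1) := mul_nonneg (by omega) (by omega)
    constructor
    · linarith
    · intro he
      have : (q - d) * (d - s - 1) = 0 := by linarith
      rcases mul_eq_zero.1 this with h | h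
      · right; omega
      · left; omega

/-- Write c₂ = C(q,2) + s and move the s units of its top row over to c₁. The smaller side loses
exactly 3s(s + 1), the larger side gains at least that much by `triMax_step` with d = s + 1, and the
induction continues with c₁ + s and c₂ - s. -/
theorem triMax_add_aux (k : ℕ) : ∀ c₁ c₂ : ℤ, c₂ ≤ k → 1 ≤ c₂ → c₂ ≤ c₁ →
    triMax c₁ + triMax c₂ ≤ triMax (c₁ + c₂) ∧
      (triMax c₁ + triMax c₂ = triMax (c₁ + c₂) → c₂ = 1 ∧ ∃ q, 2 ≤ q ∧ 2 * c₁ = q * (q - 1)) := by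
  induction k with
  | zero => intro c₁ c₂ h1 h2; push_cast at h1; omega
  | succ k ih =>
    intro c₁ c₂ hk h1 h12
    obtain ⟨q, s, hs, h⟩ := exists_cascade_of_one_le h1
    obtain ⟨p, u, hu, h'⟩ := exists_cascade_of_one_le (c := c₁ + s) (by omega)
    have hb : (s + 1) * (s + 1 - 1) ≤ 2 * (c₁ + s) := by
      obtain ⟨h0, h3, h2⟩ := h
      nlinarith
    have step := triMax_step (c := c₁ + s) (d := s + 1) (by omega) hb h' hu
    rw [show c₁ + s - (s + 1 - 1) = c₁ by ring] at step
    have hbase : Cascade (c₂ - s) q 0 := by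
      obtain ⟨h0, h3, h2⟩ := h
      exact ⟨le_rfl, by omega, by linarith⟩
    have e2 := h.triMax_eq
    have e3 := hbase.triMax_eq
    have e : triMax c₂ = triMax (c₂ - s) + 3 * ((s + 1) * (s + 1 - 1)) := by
      rw [e2, e3]; simp only [cascadeValue]; ring
    have tri : triMax c₁ + 3 * ((s + 1) * (s + 1 - 1)) = triMax (c₁ + s) →
        u = s ∧ 2 * c₁ = p * (p - 1) := by
      intro he
      rcases step.2 he with h3 | ⟨h3, h4⟩
      · obtain ⟨_, _, h6⟩ := h'
        exact ⟨by omega, by have : u = s := by omega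
                            subst this; linarith⟩
      -- Here p = s + 1 and u + 1 < p, so c₁ + s would be smaller than C(s+1,2) + s, against c₁ ≥
      -- c₂.
      · exfalso
        obtain ⟨_, _, h6⟩ := h'
        obtain ⟨_, h7, h8⟩ := h
        have : p = s + 1 := by omega
        subst this
        nlinarith
    rcases (show 0 ≤ c₂ - s by
      obtain ⟨h0, h3, h2⟩ := h
      nlinarith).eq_or_lt with hz | hpos
    · have hq : q = 1 := by
        obtain ⟨h0, h3, h2⟩ := h
        have : q * (q - 1) = 0 := by linarith
        rcases mul_eq_zero.1 this with h | h <;> omega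
      have hc : c₂ = 1 ∧ s = 1 := by
        obtain ⟨h0, h3, h2⟩ := h
        omega
      obtain ⟨rfl, rfl⟩ := hc
      rw [show (1:ℤ) - 1 = 0 by ring, triMax_zero] at e
      refine ⟨by linarith [step.1], fun he => ⟨rfl, p, ?_, ?_⟩⟩
      · have := (tri (by linarith)).2
        have h9 := h'.2.1
        by_contra hlt
        have : p = 1 := by omega
        subst this
        omega
      · exact (tri (by linarith)).2
    · have := ih (c₁ + s) (c₂ - s) (by push_cast at hk; omega) (by omega) (by omega)
      rw [show c₁ + s + (c₂ - s) = c₁ + c₂ by ring] at this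
      refine ⟨by linarith [step.1, this.1], fun he => ?_⟩
      -- Equality in both steps makes c₁ = C(p,2) and c₁ + s = C(w,2) with s ≤ p, so s = p. Then q ≥
      -- p and c₂ = C(q,2) + s exceeds c₁.
      exfalso
      have t1 := tri (by linarith [step.1, this.1])
      obtain ⟨w, hw, hw'⟩ := (this.2 (by linarith [step.1, this.1])).2
      obtain ⟨h0, h3, h2⟩ := h
      obtain ⟨g0, g3, g2⟩ := h'
      obtain ⟨rfl, t2⟩ := t1
      have hwp : p < w := by
        by_contra hle
        have : w ≤ p := by omega
        nlinarith
      have : u = p := by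
        by_contra hne
        have : p + 1 ≤ w := by omega
        have : u < p := by omega
        nlinarith
      subst this
      nlinarith

theorem triMax_add {c₁ c₂ : ℤ} (h₂ : 1 ≤ c₂) (h : c₂ ≤ c₁) :
    triMax c₁ + triMax c₂ ≤ triMax (c₁ + c₂) ∧
      (triMax c₁ + triMax c₂ = triMax (c₁ + c₂) → c₂ = 1 ∧ ∃ q, 2 ≤ q ∧ 2 * c₁ = q * (q - 1)) :=
  triMax_add_aux c₂.toNat c₁ c₂ (by omega) h₂ h

/-! ### Counting closed walks of length two, three and four inside a vertex set -/

section Counts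

variable {V : Type*} (G : SimpleGraph V)

open Classical in
/-- The adjacency indicator. -/
noncomputable def adjInd (u v : V) : ℤ := if G.Adj u v then 1 else 0

/-- The number of neighbours of `u` in `A`. -/
noncomputable def degIn (A : Finset V) (u : V) : ℤ := ∑ w ∈ A, adjInd G u w

/-- The number of closed walks of length two in `A`. -/
noncomputable def walks2 (A : Finset V) : ℤ := ∑ u ∈ A, degIn G A u

/-- The number of closed walks of length three in `A`. -/
noncomputable def walks3 (A : Finset V) : ℤ :=
  ∑ u ∈ A, ∑ v ∈ A, ∑ w ∈ A, adjInd G u v * adjInd G v w * adjInd G w u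

/-- The number of common neighbours of `u` and `v` in `A`. -/
noncomputable def codegIn (A : Finset V) (u v : V) : ℤ := ∑ w ∈ A, adjInd G u w * adjInd G w v

/-- The number of closed walks of length four in `A`. -/
noncomputable def walks4 (A : Finset V) : ℤ := ∑ u ∈ A, ∑ v ∈ A, codegIn G A u v ^ 2

variable {G}

open Classical in
theorem adjInd_comm (u v : V) : adjInd G u v = adjInd G v u := by
  unfold adjInd
  exact if_congr (G.adj_comm u v) rfl rfl

theorem adjInd_self (u : V) : adjInd G u u = 0 := by simp [adjInd]

theorem adjInd_of_adj {u v : V} (h : G.Adj u v) : adjInd G u v = 1 := if_pos h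

theorem adjInd_of_not_adj {u v : V} (h : ¬ G.Adj u v) : adjInd G u v = 0 := if_neg h

theorem adjInd_nonneg (u v : V) : 0 ≤ adjInd G u v := by
  unfold adjInd; split_ifs <;> norm_num

theorem adjInd_le_one (u v : V) : adjInd G u v ≤ 1 := by
  unfold adjInd; split_ifs <;> norm_num

theorem adjInd_sq (u v : V) : adjInd G u v * adjInd G u v = adjInd G u v := by
  unfold adjInd; split_ifs <;> norm_num

theorem degIn_nonneg (A : Finset V) (u : V) : 0 ≤ degIn G A u :=
  Finset.sum_nonneg fun _ _ => adjInd_nonneg _ _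

theorem degIn_le_card (A : Finset V) (u : V) : degIn G A u ≤ A.card := by
  have := Finset.sum_le_card_nsmul A (fun w => adjInd G u w) 1 fun _ _ => adjInd_le_one _ _
  simpa [degIn] using this

theorem adj_of_degIn_eq_card {A : Finset V} {u : V} (h : degIn G A u = A.card) :
    ∀ w ∈ A, G.Adj u w := by
  intro w hw
  by_contra hn
  have : degIn G A u < ∑ w ∈ A, (1 : ℤ) :=
    Finset.sum_lt_sum (fun _ _ => adjInd_le_one _ _) ⟨w, hw, by rw [adjInd_of_not_adj hn]; simp⟩
  simp at this
  omega

theorem degIn_eq_card {A : Finset V} {u : V} (h : ∀ w ∈ A, G.Adj u w) :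
    degIn G A u = A.card := by
  rw [degIn, Finset.sum_congr rfl fun w hw => adjInd_of_adj (h w hw)]
  simp

theorem degIn_eq_zero {A : Finset V} {u : V} (h : ∀ w ∈ A, ¬ G.Adj u w) : degIn G A u = 0 :=
  Finset.sum_eq_zero fun w hw => adjInd_of_not_adj (h w hw)

theorem one_le_degIn {A : Finset V} {u w : V} (hw : w ∈ A) (h : G.Adj u w) :
    1 ≤ degIn G A u := by
  rw [← adjInd_of_adj h]
  exact Finset.single_le_sum (f := fun w => adjInd G u w) (fun _ _ => adjInd_nonneg _ _) hw

open Classical in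
theorem degIn_eq_card_filter (A : Finset V) (u : V) :
    degIn G A u = (A.filter (G.Adj u)).card := by
  simp [degIn, adjInd]

theorem codegIn_comm (A : Finset V) (u v : V) : codegIn G A u v = codegIn G A v u :=
  Finset.sum_congr rfl fun w _ => by rw [adjInd_comm u w, adjInd_comm w v, mul_comm]

theorem codegIn_self (A : Finset V) (u : V) : codegIn G A u u = degIn G A u :=
  Finset.sum_congr rfl fun w _ => by rw [adjInd_comm w u, adjInd_sq]

variable [DecidableEq V]

theorem degIn_insert {A : Finset V} {x : V} (hx : x ∉ A) (u : V) :
    degIn G (insert x A) u = adjInd G u x + degIn G A u := Finset.sum_insert hx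

theorem degIn_insert_self {A : Finset V} {x : V} (hx : x ∉ A) :
    degIn G (insert x A) x = degIn G A x := by
  rw [degIn_insert hx, adjInd_self, zero_add]

theorem degIn_union {D E : Finset V} (h : Disjoint D E) (u : V) :
    degIn G (D ∪ E) u = degIn G D u + degIn G E u := Finset.sum_union h

theorem walks2_insert {A : Finset V} {x : V} (hx : x ∉ A) :
    walks2 G (insert x A) = walks2 G A + 2 * degIn G A x := by
  have : ∑ u ∈ A, adjInd G u x = degIn G A x :=
    Finset.sum_congr rfl fun w _ => adjInd_comm w x
  rw [walks2, Finset.sum_insert hx, degIn_insert_self hx]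
  simp only [degIn_insert hx, Finset.sum_add_distrib, this]
  rw [walks2]; ring

theorem walks2_le (A : Finset V) : walks2 G A ≤ A.card * (A.card - 1) := by
  induction A using Finset.induction_on with
  | empty => simp [walks2]
  | insert x A hx ih =>
    rw [walks2_insert hx, Finset.card_insert_of_notMem hx]
    have := degIn_le_card (G := G) A x
    push_cast
    nlinarith

/-- All pairs of distinct vertices of `A` are adjacent. -/
def CliqueOn (G : SimpleGraph V) (A : Finset V) : Prop := ∀ a ∈ A, ∀ b ∈ A, a ≠ b → G.Adj a b

omit [DecidableEq V] in
theorem CliqueOn.mono {A B : Finset V} (h : CliqueOn G B) (hAB : A ⊆ B) : CliqueOn G A :=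
  fun a ha b hb => h a (hAB ha) b (hAB hb)

theorem CliqueOn.insert_vertex {A : Finset V} {x : V} (h : CliqueOn G A) (hx : ∀ w ∈ A, G.Adj x w) :
    CliqueOn G (insert x A) := by
  intro a ha b hb hab
  rcases Finset.mem_insert.1 ha with rfl | ha' <;> rcases Finset.mem_insert.1 hb with rfl | hb'
  · exact absurd rfl hab
  · exact hx b hb'
  · exact (hx a ha').symm
  · exact h a ha' b hb' hab

theorem cliqueOn_of_walks2 {A : Finset V} (h : walks2 G A = A.card * (A.card - 1)) :
    CliqueOn G A := by
  induction A using Finset.induction_on with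
  | empty => intro a ha; simp at ha
  | insert x A hx ih =>
    rw [walks2_insert hx, Finset.card_insert_of_notMem hx] at h
    have h1 := degIn_le_card (G := G) A x
    have h2 := walks2_le (G := G) A
    push_cast at h
    exact (ih (by nlinarith)).insert_vertex (adj_of_degIn_eq_card (by nlinarith))

theorem CliqueOn.walks2_eq {A : Finset V} (h : CliqueOn G A) :
    walks2 G A = A.card * (A.card - 1) := by
  induction A using Finset.induction_on with
  | empty => simp [walks2]
  | insert x A hx ih =>
    rw [walks2_insert hx, Finset.card_insert_of_notMem hx,
      ih (h.mono (Finset.subset_insert _ _)), degIn_eq_card]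
    · push_cast; ring
    · intro w hw
      exact h x (by simp) w (by simp [hw]) (fun e => hx (e ▸ hw))

open Classical in
/-- The neighbours of `x` in `A`. -/
noncomputable def nbrs (G : SimpleGraph V) (A : Finset V) (x : V) : Finset V := A.filter (G.Adj x)

omit [DecidableEq V] in
theorem mem_nbrs {A : Finset V} {x w : V} : w ∈ nbrs G A x ↔ w ∈ A ∧ G.Adj x w := by
  simp [nbrs]

omit [DecidableEq V] in
theorem card_nbrs (A : Finset V) (x : V) : ((nbrs G A x).card : ℤ) = degIn G A x :=
  (degIn_eq_card_filter A x).symm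

omit [DecidableEq V] in
theorem walks2_nbrs (A : Finset V) (x : V) :
    walks2 G (nbrs G A x) =
      ∑ u ∈ A, ∑ w ∈ A, adjInd G x u * adjInd G u w * adjInd G w x := by
  simp only [walks2, degIn, nbrs, Finset.sum_filter]
  refine Finset.sum_congr rfl fun u _ => ?_
  by_cases hu : G.Adj x u
  · rw [if_pos hu]
    refine Finset.sum_congr rfl fun w _ => ?_
    by_cases hw : G.Adj x w
    · simp [hw, adjInd_of_adj hu, adjInd_of_adj hw.symm]
    · simp [hw, adjInd_comm w x, adjInd_of_not_adj hw]
  · simp [hu, adjInd_of_not_adj hu]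

/-- A closed 3-walk through x visits it in exactly one of its three positions, and the other two
vertices form an ordered edge among the neighbours of x. -/
theorem walks3_insert {A : Finset V} {x : V} (hx : x ∉ A) :
    walks3 G (insert x A) = walks3 G A + 3 * walks2 G (nbrs G A x) := by
  rw [walks2_nbrs]
  simp only [walks3, Finset.sum_insert hx, adjInd_self, Finset.sum_add_distrib, zero_mul, mul_zero,
    Finset.sum_const_zero, zero_add]
  have e1 : ∑ u ∈ A, ∑ v ∈ A, adjInd G u v * adjInd G v x * adjInd G x u =
      ∑ u ∈ A, ∑ w ∈ A, adjInd G x u * adjInd G u w * adjInd G w x :=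
    Finset.sum_congr rfl fun u _ => Finset.sum_congr rfl fun v _ => by ring
  have e2 : ∑ u ∈ A, ∑ v ∈ A, adjInd G u x * adjInd G x v * adjInd G v u =
      ∑ u ∈ A, ∑ w ∈ A, adjInd G x u * adjInd G u w * adjInd G w x := by
    rw [Finset.sum_comm]
    exact Finset.sum_congr rfl fun u _ => Finset.sum_congr rfl fun v _ => by ring
  rw [e1, e2]
  ring

theorem codegIn_insert {A : Finset V} {x : V} (hx : x ∉ A) (u w : V) :
    codegIn G (insert x A) u w = codegIn G A u w + adjInd G x u * adjInd G x w := by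
  rw [codegIn, Finset.sum_insert hx, adjInd_comm u x, add_comm, codegIn]

theorem walks4_insert {A : Finset V} {x : V} (hx : x ∉ A) :
    walks4 G (insert x A) =
      ∑ u ∈ A, ∑ w ∈ A, (codegIn G A u w + adjInd G x u * adjInd G x w) ^ 2 +
        2 * ∑ u ∈ A, codegIn G A u x ^ 2 + degIn G A x ^ 2 := by
  simp only [walks4, Finset.sum_insert hx, codegIn_insert hx, adjInd_self, Finset.sum_add_distrib,
    zero_mul, mul_zero, add_zero, codegIn_self]
  have e : ∑ u ∈ A, codegIn G A x u ^ 2 = ∑ u ∈ A, codegIn G A u x ^ 2 :=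
    Finset.sum_congr rfl fun u _ => by rw [codegIn_comm]
  rw [e]
  ring

/-! ### Gluing two vertex sets at a cut vertex -/

section Glue

variable {D E : Finset V} (hDE : Disjoint D E) (hno : ∀ u ∈ D, ∀ w ∈ E, ¬ G.Adj u w)
include hDE hno

theorem walks2_union : walks2 G (D ∪ E) = walks2 G D + walks2 G E := by
  rw [walks2, Finset.sum_union hDE, walks2, walks2]
  congr 1 <;> refine Finset.sum_congr rfl fun u hu => ?_ <;> rw [degIn_union hDE]
  · rw [degIn_eq_zero (A := E) fun w hw => hno u hu w hw, add_zero]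
  · rw [degIn_eq_zero (A := D) fun w hw h => hno w hw u hu h.symm, zero_add]

theorem codegIn_union_left {u : V} (hu : u ∈ D) (w : V) :
    codegIn G (D ∪ E) u w = codegIn G D u w := by
  rw [codegIn, Finset.sum_union hDE, codegIn, add_eq_left]
  exact Finset.sum_eq_zero fun z hz => by rw [adjInd_of_not_adj (hno u hu z hz), zero_mul]

theorem codegIn_union_right {u : V} (hu : u ∈ E) (w : V) :
    codegIn G (D ∪ E) u w = codegIn G E u w := by
  rw [codegIn, Finset.sum_union hDE, codegIn, add_eq_right]
  exact Finset.sum_eq_zero fun z hz => by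
    rw [adjInd_of_not_adj fun h => hno z hz u hu h.symm, zero_mul]

theorem codegIn_cross {u w : V} (hu : u ∈ D) (hw : w ∈ E) : codegIn G (D ∪ E) u w = 0 := by
  rw [codegIn_union_left hDE hno hu]
  exact Finset.sum_eq_zero fun z hz => by rw [adjInd_of_not_adj (hno z hz w hw), mul_zero]

theorem walks3_union : walks3 G (D ∪ E) = walks3 G D + walks3 G E := by
  have e : ∀ A : Finset V, walks3 G A = ∑ u ∈ A, ∑ v ∈ A, codegIn G A u v * adjInd G u v := by
    intro A
    refine Finset.sum_congr rfl fun u _ => ?_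
    rw [Finset.sum_comm]
    refine Finset.sum_congr rfl fun w _ => ?_
    rw [codegIn, Finset.sum_mul]
    exact Finset.sum_congr rfl fun v _ => by rw [adjInd_comm w u]
  simp only [e, Finset.sum_union hDE]
  congr 1
  · refine Finset.sum_congr rfl fun u hu => ?_
    rw [Finset.sum_congr rfl fun v hv => by rw [codegIn_union_left hDE hno hu], add_eq_left]
    exact Finset.sum_eq_zero fun v hv => by rw [adjInd_of_not_adj (hno u hu v hv), mul_zero]
  · refine Finset.sum_congr rfl fun u hu => ?_
    rw [add_comm, Finset.sum_congr rfl fun v hv => by rw [codegIn_union_right hDE hno hu],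
      add_eq_left]
    exact Finset.sum_eq_zero fun v hv => by
      rw [adjInd_of_not_adj fun h => hno v hv u hu h.symm, mul_zero]

variable {x : V} (hxD : x ∉ D) (hxE : x ∉ E)
include hxD hxE

theorem walks2_glue :
    walks2 G (insert x (D ∪ E)) = walks2 G (insert x D) + walks2 G (insert x E) := by
  rw [walks2_insert (by simp [hxD, hxE]), walks2_insert hxD, walks2_insert hxE,
    walks2_union hDE hno, degIn_union hDE]
  ring

theorem walks3_glue :
    walks3 G (insert x (D ∪ E)) = walks3 G (insert x D) + walks3 G (insert x E) := by
  have : nbrs G (D ∪ E) x = nbrs G D x ∪ nbrs G E x := by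
    ext; simp only [mem_nbrs, Finset.mem_union]; tauto
  rw [walks3_insert (by simp [hxD, hxE]), walks3_insert hxD, walks3_insert hxE,
    walks3_union hDE hno, this, walks2_union]
  · ring
  · exact hDE.mono (fun _ h => (mem_nbrs.1 h).1) (fun _ h => (mem_nbrs.1 h).1)
  · exact fun u hu w hw => hno u (mem_nbrs.1 hu).1 w (mem_nbrs.1 hw).1

/-- New closed 4-walks come from two sources: a neighbour of x in D and one in E now have x as their
only common neighbour, in two orders; and the square of the degree of x gains a cross term. Each
source contributes twice the product of degrees. -/
theorem walks4_glue :
    walks4 G (insert x (D ∪ E)) = walks4 G (insert x D) + walks4 G (insert x E) +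
      4 * (degIn G D x * degIn G E x) := by
  rw [walks4_insert (by simp [hxD, hxE]), walks4_insert hxD, walks4_insert hxE, degIn_union hDE]
  have e1 : ∑ u ∈ D ∪ E, codegIn G (D ∪ E) u x ^ 2 =
      ∑ u ∈ D, codegIn G D u x ^ 2 + ∑ u ∈ E, codegIn G E u x ^ 2 := by
    rw [Finset.sum_union hDE]
    congr 1 <;> refine Finset.sum_congr rfl fun u hu => ?_
    · rw [codegIn_union_left hDE hno hu]
    · rw [codegIn_union_right hDE hno hu]
  have cross : ∀ u w, (adjInd G x u * adjInd G x w) ^ 2 = adjInd G x u * adjInd G x w := by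
    intro u w
    rw [mul_pow, pow_two, pow_two, adjInd_sq, adjInd_sq]
  have e2 : ∑ u ∈ D ∪ E, ∑ w ∈ D ∪ E,
        (codegIn G (D ∪ E) u w + adjInd G x u * adjInd G x w) ^ 2 =
      ∑ u ∈ D, ∑ w ∈ D, (codegIn G D u w + adjInd G x u * adjInd G x w) ^ 2 +
      ∑ u ∈ E, ∑ w ∈ E, (codegIn G E u w + adjInd G x u * adjInd G x w) ^ 2 +
      2 * (degIn G D x * degIn G E x) := by
    simp only [Finset.sum_union hDE, Finset.sum_add_distrib]
    have a1 : ∑ u ∈ D, ∑ w ∈ D, (codegIn G (D ∪ E) u w + adjInd G x u * adjInd G x w) ^ 2 =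
        ∑ u ∈ D, ∑ w ∈ D, (codegIn G D u w + adjInd G x u * adjInd G x w) ^ 2 :=
      Finset.sum_congr rfl fun u hu => Finset.sum_congr rfl fun w _ => by
        rw [codegIn_union_left hDE hno hu]
    have a2 : ∑ u ∈ E, ∑ w ∈ E, (codegIn G (D ∪ E) u w + adjInd G x u * adjInd G x w) ^ 2 =
        ∑ u ∈ E, ∑ w ∈ E, (codegIn G E u w + adjInd G x u * adjInd G x w) ^ 2 :=
      Finset.sum_congr rfl fun u hu => Finset.sum_congr rfl fun w _ => by
        rw [codegIn_union_right hDE hno hu]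
    have a3 : ∑ u ∈ D, ∑ w ∈ E, (codegIn G (D ∪ E) u w + adjInd G x u * adjInd G x w) ^ 2 =
        degIn G D x * degIn G E x := by
      rw [degIn, degIn, Finset.sum_mul_sum]
      exact Finset.sum_congr rfl fun u hu => Finset.sum_congr rfl fun w hw => by
        rw [codegIn_cross hDE hno hu hw, zero_add, cross]
    have a4 : ∑ u ∈ E, ∑ w ∈ D, (codegIn G (D ∪ E) u w + adjInd G x u * adjInd G x w) ^ 2 =
        degIn G D x * degIn G E x := by
      rw [mul_comm, degIn, degIn, Finset.sum_mul_sum]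
      exact Finset.sum_congr rfl fun u hu => Finset.sum_congr rfl fun w hw => by
        rw [codegIn_comm, codegIn_cross hDE hno hw hu, zero_add, cross]
    rw [a1, a2, a3, a4]
    ring
  rw [e1, e2]
  ring

end Glue

end Counts

/-! ### The extremal graphs and their walk counts -/

section Extremal

variable {V : Type*} [DecidableEq V] {G : SimpleGraph V}

theorem CliqueOn.adjInd_eq {Q : Finset V} (h : CliqueOn G Q) {u w : V} (hu : u ∈ Q) (hw : w ∈ Q) :
    adjInd G u w = 1 - if u = w then 1 else 0 := by
  split_ifs with e
  · rw [e, adjInd_self]; norm_num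
  · rw [adjInd_of_adj (h u hu w hw e)]; norm_num

theorem CliqueOn.walks3_eq {Q : Finset V} (h : CliqueOn G Q) :
    walks3 G Q = Q.card * (Q.card - 1) * (Q.card - 2) := by
  induction Q using Finset.induction_on with
  | empty => simp [walks3]
  | insert x A hx ih =>
    have hA := h.mono (Finset.subset_insert x A)
    have : nbrs G A x = A := by
      ext w
      rw [mem_nbrs]
      refine ⟨fun h => h.1, fun hw => ⟨hw, h x (by simp) w (by simp [hw]) ?_⟩⟩
      rintro rfl
      exact hx hw
    rw [walks3_insert hx, ih hA, this, hA.walks2_eq, Finset.card_insert_of_notMem hx]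
    push_cast
    ring

theorem CliqueOn.codegIn_eq {Q : Finset V} (h : CliqueOn G Q) {u w : V} (hu : u ∈ Q)
    (hw : w ∈ Q) : codegIn G Q u w = (Q.card - 2) + if u = w then 1 else 0 := by
  have e : codegIn G Q u w = ∑ z ∈ Q, (1 - (if u = z then 1 else 0) - (if z = w then 1 else 0) +
      if u = z then (if u = w then 1 else 0) else 0) := by
    refine Finset.sum_congr rfl fun z hz => ?_
    rw [h.adjInd_eq hu hz, h.adjInd_eq hz hw]
    split_ifs <;> simp_all
  rw [e]
  simp only [Finset.sum_add_distrib, Finset.sum_sub_distrib, Finset.sum_ite_eq,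
    Finset.sum_ite_eq', hu, hw, if_true, Finset.sum_const, nsmul_eq_mul]
  ring

/-- The number of closed walks of length four in `K_r^t`. -/
def coreWalks4 (r t : ℤ) : ℤ :=
  r ^ 2 * (r - 2) ^ 2 + 2 * r ^ 2 - 3 * r + t ^ 2 * (4 * r - 6) + 4 * t

/-- With t the degree of v into Q, a clique vertex u has t common neighbours with v, less one if u
is adjacent to v. Two clique vertices gain the common neighbour v exactly when both are adjacent to
it. The total thus depends only on |Q| and t. -/
theorem CliqueOn.walks4_insert {Q : Finset V} (h : CliqueOn G Q) {v : V} (hv : v ∉ Q) :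
    walks4 G (insert v Q) = coreWalks4 Q.card (degIn G Q v) := by
  set t := degIn G Q v with ht
  set k : ℤ := Q.card - 2 with hk
  have hsum : ∑ w ∈ Q, adjInd G v w = t := rfl
  rw [SOrder.walks4_insert hv]
  have e1 : ∀ u ∈ Q, codegIn G Q u v = t - adjInd G v u := by
    intro u hu
    rw [codegIn, Finset.sum_congr rfl fun w hw => by
      rw [h.adjInd_eq hu hw, sub_mul, one_mul, ite_mul, one_mul, zero_mul, adjInd_comm w v]]
    rw [Finset.sum_sub_distrib, Finset.sum_ite_eq, if_pos hu, hsum]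
  have e2 : ∑ u ∈ Q, codegIn G Q u v ^ 2 = Q.card * t ^ 2 - 2 * t ^ 2 + t := by
    have : ∀ u ∈ Q, codegIn G Q u v ^ 2 = t ^ 2 - 2 * t * adjInd G v u + adjInd G v u := by
      intro u hu
      rw [e1 u hu]
      linear_combination adjInd_sq (G := G) v u
    rw [Finset.sum_congr rfl this, Finset.sum_add_distrib, Finset.sum_sub_distrib,
      ← Finset.mul_sum, hsum]
    simp
    ring
  have e3 : ∀ u ∈ Q, ∑ w ∈ Q, (codegIn G Q u w + adjInd G v u * adjInd G v w) ^ 2 =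
      Q.card * k ^ 2 + (1 + 2 * k + 2 * adjInd G v u) + (2 * k + 1) * t * adjInd G v u := by
    intro u hu
    have : ∀ w ∈ Q, (codegIn G Q u w + adjInd G v u * adjInd G v w) ^ 2 =
        k ^ 2 + (if u = w then (1 + 2 * k + 2 * adjInd G v u) else 0) +
          (2 * k + 1) * adjInd G v u * adjInd G v w := by
      intro w hw
      rw [h.codegIn_eq hu hw, ← hk]
      have hb := adjInd_sq (G := G) v u
      have hb' := adjInd_sq (G := G) v w
      split_ifs with e
      · subst e
        linear_combination ((adjInd G v u) ^ 2 + adjInd G v u + 2) * hb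
      · linear_combination (adjInd G v w) ^ 2 * hb + adjInd G v u * hb'
    rw [Finset.sum_congr rfl this, Finset.sum_add_distrib, Finset.sum_add_distrib,
      ← Finset.mul_sum, hsum, Finset.sum_ite_eq, if_pos hu]
    simp
    ring
  rw [e2, Finset.sum_congr rfl e3]
  simp only [Finset.sum_add_distrib, ← Finset.mul_sum, hsum, Finset.sum_const, nsmul_eq_mul]
  rw [coreWalks4, hk]
  ring

/-- The vertices of `A` induce `K_r^t` with pendant edges added to the vertex `x`, which is
adjacent to all others. -/
def IsExtremal (G : SimpleGraph V) (A : Finset V) (x : V) (r t : ℤ) : Prop :=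
  ∃ Q v, Q ⊆ A ∧ v ∈ A ∧ v ∉ Q ∧ x ∈ Q ∧ (Q.card : ℤ) = r ∧ CliqueOn G Q ∧ degIn G Q v = t ∧
    G.Adj v x ∧ ∀ w ∈ A, w ∉ Q → w ≠ v → ∀ u ∈ A, G.Adj w u ↔ u = x

/-- The number of closed walks of length four in `K_r^t` with pendant edges at a vertex of
degree `r`, `n` vertices altogether. -/
def extremalWalks4 (n r t : ℤ) : ℤ :=
  coreWalks4 r t + 2 * (n - r - 1) ^ 2 + 4 * (n - r - 1) * r

theorem walks_star {P : Finset V} {x : V} (hx : x ∉ P) (hadj : ∀ w ∈ P, G.Adj x w)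
    (hind : ∀ u ∈ P, ∀ w ∈ P, ¬ G.Adj u w) :
    walks2 G (insert x P) = 2 * P.card ∧ walks3 G (insert x P) = 0 ∧
      walks4 G (insert x P) = 2 * (P.card : ℤ) ^ 2 := by
  have h0 : walks2 G P = 0 := Finset.sum_eq_zero fun u hu => degIn_eq_zero (hind u hu)
  have h1 : nbrs G P x = P := by
    ext w; rw [mem_nbrs]; exact ⟨fun h => h.1, fun h => ⟨h, hadj w h⟩⟩
  have hd := degIn_eq_card hadj
  have hc : ∀ u ∈ P, ∀ w, codegIn G P u w = 0 := fun u hu w =>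
    Finset.sum_eq_zero fun z hz => by rw [adjInd_of_not_adj (hind u hu z hz), zero_mul]
  refine ⟨?_, ?_, ?_⟩
  · rw [walks2_insert hx, h0, hd]; ring
  · rw [walks3_insert hx, h1, h0, walks3]
    simp only [mul_zero, add_zero]
    refine Finset.sum_eq_zero fun u hu => Finset.sum_eq_zero fun v hv =>
      Finset.sum_eq_zero fun w _ => ?_
    rw [adjInd_of_not_adj (hind u hu v hv), zero_mul, zero_mul]
  · rw [walks4_insert hx, hd, Finset.sum_eq_zero (f := fun u => codegIn G P u x ^ 2)
      fun u hu => by rw [hc u hu]; norm_num]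
    have : ∀ u ∈ P, ∑ w ∈ P, (codegIn G P u w + adjInd G x u * adjInd G x w) ^ 2 = P.card := by
      intro u hu
      rw [Finset.sum_congr rfl fun w hw => by
        rw [hc u hu, adjInd_of_adj (hadj u hu), adjInd_of_adj (hadj w hw)]]
      simp
    rw [Finset.sum_congr rfl this]
    simp
    ring

omit [DecidableEq V] in
theorem IsExtremal.adj {A : Finset V} {x : V} {r t : ℤ} (h : IsExtremal G A x r t) :
    ∀ w ∈ A, w ≠ x → G.Adj x w := by
  obtain ⟨Q, v, hQA, hvA, hvQ, hxQ, hr, hQ, ht, hvx, hP⟩ := h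
  intro w hw hwx
  by_cases hwQ : w ∈ Q
  · exact hQ x hxQ w hwQ hwx.symm
  by_cases hwv : w = v
  · subst hwv; exact hvx.symm
  · exact ((hP w hw hwQ hwv x (hQA hxQ)).2 rfl).symm

/-- The set is K_r^t and a star glued at x, and x is adjacent to everything in both parts; the three
counts follow from the gluing formulas. -/
theorem IsExtremal.walks {A : Finset V} {x : V} {r t : ℤ} (h : IsExtremal G A x r t) :
    walks2 G A = r * (r - 1) + 2 * t + 2 * (A.card - r - 1) ∧
    walks3 G A = r * (r - 1) * (r - 2) + 3 * (t * (t - 1)) ∧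
    walks4 G A = extremalWalks4 A.card r t := by
  have hfull := h.adj
  obtain ⟨Q, v, hQA, hvA, hvQ, hxQ, hr, hQ, ht, hvx, hP⟩ := h
  have hsub : insert v Q ⊆ A := Finset.insert_subset hvA hQA
  set P := A \ insert v Q with hPdef
  set D := (insert v Q).erase x with hDdef
  have hmemP : ∀ w ∈ P, w ∈ A ∧ w ∉ Q ∧ w ≠ v := by
    intro w hw
    simp only [hPdef, Finset.mem_sdiff, Finset.mem_insert, not_or] at hw
    exact ⟨hw.1, hw.2.2, hw.2.1⟩
  have hxP : x ∉ P := fun h => (hmemP x h).2.1 hxQ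
  have hxD : x ∉ D := by simp [hDdef]
  have hD : insert x D = insert v Q := Finset.insert_erase (by simp [hxQ])
  have hA : A = insert x (D ∪ P) := by
    rw [← Finset.insert_union, hD, hPdef, Finset.union_sdiff_of_subset hsub]
  have hdisj : Disjoint D P :=
    Finset.disjoint_sdiff.mono_left (Finset.erase_subset _ _)
  have hno : ∀ u ∈ D, ∀ w ∈ P, ¬ G.Adj u w := by
    intro u hu w hw huw
    obtain ⟨h1, h2, h3⟩ := hmemP w hw
    have huA : u ∈ A := hsub (Finset.mem_of_mem_erase hu)
    exact Finset.ne_of_mem_erase hu ((hP w h1 h2 h3 u huA).1 huw.symm)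
  have hind : ∀ u ∈ P, ∀ w ∈ P, ¬ G.Adj u w := by
    intro u hu w hw huw
    obtain ⟨h1, h2, h3⟩ := hmemP u hu
    have := (hP u h1 h2 h3 w (hmemP w hw).1).1 huw
    exact hxP (this ▸ hw)
  have hxP' : ∀ w ∈ P, G.Adj x w := fun w hw =>
    hfull w (hmemP w hw).1 (fun e => hxP (e ▸ hw))
  have hcardQ : ((insert v Q).card : ℤ) = r + 1 := by
    rw [Finset.card_insert_of_notMem hvQ]; push_cast; rw [hr]
  have hcardP : (P.card : ℤ) = A.card - r - 1 := by
    have := Finset.card_sdiff_add_card_eq_card hsub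
    rw [← hPdef] at this
    have h2 : (P.card : ℤ) + (insert v Q).card = A.card := by exact_mod_cast this
    linarith
  have hdD : degIn G D x = r := by
    rw [degIn_eq_card]
    · have := Finset.card_erase_add_one (s := insert v Q) (a := x) (by simp [hxQ])
      have h2 : (D.card : ℤ) + 1 = (insert v Q).card := by exact_mod_cast this
      linarith
    · intro w hw
      exact hfull w (hsub (Finset.mem_of_mem_erase hw)) (Finset.ne_of_mem_erase hw)
  have hdP : degIn G P x = P.card := degIn_eq_card hxP'
  obtain ⟨s2, s3, s4⟩ := walks_star hxP hxP' hind
  have c2 := hQ.walks2_eq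
  have c3 := hQ.walks3_eq
  have c4 := hQ.walks4_insert hvQ
  rw [hr] at c2 c3 c4
  rw [ht] at c4
  have hn : walks2 G (nbrs G Q v) = t * (t - 1) := by
    rw [(hQ.mono fun w hw => (mem_nbrs.1 hw).1).walks2_eq, card_nbrs, ht]
  have g2 := walks2_glue hdisj hno hxD hxP
  have g3 := walks3_glue hdisj hno hxD hxP
  have g4 := walks4_glue hdisj hno hxD hxP
  rw [← hA, hD] at g2 g3 g4
  rw [walks2_insert hvQ, c2, ht, s2, hcardP] at g2
  rw [walks3_insert hvQ, c3, hn, s3] at g3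
  rw [c4, s4, hdD, hdP, hcardP] at g4
  refine ⟨by rw [g2], by rw [g3]; ring, by rw [g4, extremalWalks4]; ring⟩

/-- Pendant vertices may be added at `x`. -/
theorem IsExtremal.extend {A B : Finset V} {x : V} {r t : ℤ} (h : IsExtremal G B x r t)
    (hBA : B ⊆ A) (hP : ∀ w ∈ A, w ∉ B → ∀ u ∈ A, G.Adj w u ↔ u = x) :
    IsExtremal G A x r t := by
  obtain ⟨Q, v, hQA, hvA, hvQ, hxQ, hr, hQ, ht, hvx, hB⟩ := h
  refine ⟨Q, v, hQA.trans hBA, hBA hvA, hvQ, hxQ, hr, hQ, ht, hvx, fun w hw hwQ hwv u hu => ?_⟩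
  by_cases hwB : w ∈ B
  · by_cases huB : u ∈ B
    · exact hB w hwB hwQ hwv u huB
    · have hxB : x ∈ B := hQA hxQ
      have h1 : u ≠ x := fun e => huB (e ▸ hxB)
      have h2 : w ≠ x := fun e => hwQ (e ▸ hxQ)
      refine ⟨fun hwu => absurd ((hP u hu huB w hw).1 hwu.symm) h2, fun e => absurd e h1⟩
  · exact hP w hw hwB u hu

/-- The distinguished vertex may be replaced by any vertex adjacent to all others. -/
theorem IsExtremal.change {A : Finset V} {x y : V} {r t : ℤ} (h : IsExtremal G A x r t)
    (hy : y ∈ A) (hfull : ∀ w ∈ A, w ≠ y → G.Adj y w) : IsExtremal G A y r t := by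
  by_cases hxy : y = x
  · rwa [hxy]
  obtain ⟨Q, v, hQA, hvA, hvQ, hxQ, hr, hQ, ht, hvx, hP⟩ := h
  by_cases hyQ : y ∈ Q
  -- A pendant vertex would be adjacent to y ≠ x, so there are none and the same Q and v serve.
  · refine ⟨Q, v, hQA, hvA, hvQ, hyQ, hr, hQ, ht, ?_, fun w hw hwQ hwv u hu => ?_⟩
    · exact (hfull v hvA fun e => hvQ (e ▸ hyQ)).symm
    · have := (hP w hw hwQ hwv y hy).1 (hfull w hw fun e => hwQ (e ▸ hyQ)).symm
      exact absurd this hxy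
  by_cases hyv : y = v
  · subst hyv
    have hall : ∀ w ∈ Q, G.Adj y w := fun w hw => hfull w (hQA hw) fun e => hyQ (e ▸ hw)
    -- If y = v is adjacent to everything, then Q together with v is a clique, and x and v exchange
    -- their roles.
    have hxe : x ∉ Q.erase x := by simp
    have hye : y ∉ Q.erase x := fun h => hyQ (Finset.mem_of_mem_erase h)
    have hcard : (insert y (Q.erase x)).card = Q.card := by
      rw [Finset.card_insert_of_notMem hye, Finset.card_erase_add_one hxQ]
    have hx' : x ∉ insert y (Q.erase x) := by
      simp only [Finset.mem_insert, not_or]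
      exact ⟨fun e => hxy e.symm, hxe⟩
    have hins : CliqueOn G (insert y Q) := hQ.insert_vertex hall
    refine ⟨insert y (Q.erase x), x, ?_, hQA hxQ, hx', by simp, by rw [hcard, hr], ?_, ?_, ?_, ?_⟩
    · exact Finset.insert_subset hvA ((Finset.erase_subset _ _).trans hQA)
    · exact hins.mono (Finset.insert_subset_insert _ (Finset.erase_subset _ _))
    · rw [← ht, degIn_eq_card hall, degIn_eq_card, hcard]
      intro w hw
      refine hins x (by simp [hxQ]) w ?_ fun e => hx' (e ▸ hw)
      exact (Finset.insert_subset_insert _ (Finset.erase_subset _ _)) hw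
    · exact hvx.symm
    · intro w hw hwQ hwx u hu
      simp only [Finset.mem_insert, Finset.mem_erase, not_or, not_and_or, not_not] at hwQ
      have hwQ' : w ∉ Q := by
        rcases hwQ.2 with h | h
        · exact absurd h hwx
        · exact h
      have := (hP w hw hwQ' hwQ.1 y hy).1 (hfull w hw hwQ.1).symm
      exact absurd this hxy
  · have := (hP y hy hyQ hyv v hvA).1 (hfull v hvA fun e => hyv e.symm)
    exact absurd (this ▸ hxQ) hvQ

end Extremal

/-! ### Connectedness, cut vertices and the edge count in the equality case -/

section Structure

variable {V : Type*} [DecidableEq V] {G : SimpleGraph V}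

omit [DecidableEq V] in
variable (G) in
/-- The graph induced on `A` is connected. -/
def ConnOn (A : Finset V) : Prop :=
  A.Nonempty ∧ ∀ S ⊆ A, S.Nonempty → S ≠ A → ∃ a ∈ S, ∃ b ∈ A, b ∉ S ∧ G.Adj a b

/-- An edge leaving a subset of D cannot reach E, so it stays within D and x. A subset containing x
is handled through its complement. -/
theorem ConnOn.attach {D E : Finset V} {x : V} (h : ConnOn G (insert x (D ∪ E)))
    (hno : ∀ u ∈ D, ∀ w ∈ E, ¬ G.Adj u w) (hD : x ∉ D) : ConnOn G (insert x D) := by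
  have key : ∀ S ⊆ D, S.Nonempty → ∃ a ∈ S, ∃ b ∈ insert x D, b ∉ S ∧ G.Adj a b := by
    intro S hS hne
    have hx : x ∉ S := fun hx => hD (hS hx)
    obtain ⟨a, ha, b, hb, hbS, hab⟩ := h.2 S
      (fun z hz => Finset.mem_insert_of_mem (Finset.mem_union_left _ (hS hz))) hne
      (fun e => hx (by rw [e]; simp))
    refine ⟨a, ha, b, ?_, hbS, hab⟩
    rcases Finset.mem_insert.1 hb with rfl | hb
    · simp
    · rcases Finset.mem_union.1 hb with hb | hb
      · simp [hb]
      · exact absurd hab (hno a (hS ha) b hb)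
  refine ⟨⟨x, by simp⟩, fun S hS hne hSA => ?_⟩
  by_cases hx : x ∈ S
  · obtain ⟨a, ha, b, hb, hbT, hab⟩ := key (insert x D \ S)
      (by
        intro z hz
        rw [Finset.mem_sdiff, Finset.mem_insert] at hz
        rcases hz.1 with rfl | h
        · exact absurd hx hz.2
        · exact h)
      (Finset.sdiff_nonempty.2 fun hsub => hSA (hS.antisymm hsub))
    rw [Finset.mem_sdiff] at ha hbT
    exact ⟨b, by tauto, a, ha.1, ha.2, hab.symm⟩
  · exact key S (fun z hz => (Finset.mem_insert.1 (hS hz)).resolve_left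
      (fun e => hx (e ▸ hz))) hne

theorem ConnOn.exists_glue {A : Finset V} (h : ConnOn G A) {x : V} (hx : x ∈ A)
    (hcard : 2 ≤ A.card) (hcut : ¬ ConnOn G (A.erase x)) :
    ∃ D E : Finset V, D.Nonempty ∧ E.Nonempty ∧ Disjoint D E ∧ x ∉ D ∧ x ∉ E ∧
      (∀ u ∈ D, ∀ w ∈ E, ¬ G.Adj u w) ∧ A = insert x (D ∪ E) ∧
      ConnOn G (insert x D) ∧ ConnOn G (insert x E) := by
  have hne : (A.erase x).Nonempty := by
    rw [← Finset.card_pos, Finset.card_erase_of_mem hx]; omega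
  simp only [ConnOn, not_and, not_forall] at hcut
  obtain ⟨S, hS, hSne, hSA, hno⟩ := hcut hne
  push Not at hno
  have hxS : x ∉ S := fun h => by simpa using hS h
  have hu : S ∪ (A.erase x \ S) = A.erase x := Finset.union_sdiff_of_subset hS
  have hA : A = insert x (S ∪ (A.erase x \ S)) := by rw [hu, Finset.insert_erase hx]
  have hno' : ∀ u ∈ S, ∀ w ∈ A.erase x \ S, ¬ G.Adj u w := by
    intro u hu w hw
    rw [Finset.mem_sdiff] at hw
    exact hno u hu w hw.1 hw.2
  have hxE : x ∉ A.erase x \ S := by simp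
  refine ⟨S, A.erase x \ S, hSne, Finset.sdiff_nonempty.2 fun hsub => hSA (hS.antisymm hsub),
    Finset.disjoint_sdiff, hxS, hxE, hno', hA, (hA ▸ h).attach hno' hxS, ?_⟩
  rw [hA, Finset.union_comm] at h
  exact h.attach (fun u hu w hw huw => hno' w hw u hu huw.symm) hxE

omit [DecidableEq V] in
theorem ConnOn.one_le_degIn {A : Finset V} (h : ConnOn G A) {u : V} (hu : u ∈ A)
    (hcard : 2 ≤ A.card) : 1 ≤ degIn G A u := by
  obtain ⟨a, ha, b, hb, -, hab⟩ := h.2 {u} (by simpa using hu) (by simp) (by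
    rintro rfl; simp at hcard)
  rw [Finset.mem_singleton] at ha
  subst ha
  exact SOrder.one_le_degIn hb hab

omit [DecidableEq V] in
theorem two_le_degIn {A : Finset V} {u a b : V} (ha : a ∈ A) (hb : b ∈ A) (hab : a ≠ b)
    (hua : G.Adj u a) (hub : G.Adj u b) : 2 ≤ degIn G A u := by
  have : 1 < (nbrs G A u).card :=
    Finset.one_lt_card.2 ⟨a, mem_nbrs.2 ⟨ha, hua⟩, b, mem_nbrs.2 ⟨hb, hub⟩, hab⟩
  rw [← card_nbrs]
  omega

/-- If u were the only neighbour of v, deleting u would isolate v from the remaining vertices. -/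
theorem two_le_degIn_of_not_cut {A : Finset V} (h : ConnOn G A) (hcard : 3 ≤ A.card)
    (hcut : ∀ x ∈ A, ConnOn G (A.erase x)) {v : V} (hv : v ∈ A) : 2 ≤ degIn G A v := by
  obtain ⟨a, ha, u, hu, -, hau⟩ := h.2 {v} (by simpa using hv) (by simp) (by
    rintro rfl; simp at hcard)
  rw [Finset.mem_singleton] at ha
  subst ha
  obtain ⟨a', ha', b, hb, -, hab⟩ := (hcut u hu).2 {a}
    (by simpa using ⟨hau.ne, hv⟩) (by simp) (by
    intro e
    have := Finset.card_erase_of_mem hu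
    rw [← e] at this
    simp at this
    omega)
  rw [Finset.mem_singleton] at ha'
  subst ha'
  exact two_le_degIn hu (Finset.mem_of_mem_erase hb) (Finset.ne_of_mem_erase hb).symm hau hab

theorem walks2_union_eq {Q O : Finset V} (h : Disjoint Q O) :
    walks2 G (Q ∪ O) = walks2 G Q + walks2 G O + 2 * ∑ u ∈ O, degIn G Q u := by
  have : ∑ u ∈ Q, degIn G O u = ∑ u ∈ O, degIn G Q u := by
    simp only [degIn]
    rw [Finset.sum_comm]
    exact Finset.sum_congr rfl fun u _ => Finset.sum_congr rfl fun w _ => adjInd_comm _ _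
  rw [walks2, Finset.sum_union h]
  simp only [degIn_union h, Finset.sum_add_distrib, this]
  rw [walks2, walks2]
  ring

omit [DecidableEq V] in
theorem ConnOn.one_le_sum_degIn {A Q O : Finset V} (h : ConnOn G A) (hQ : Q ⊆ A)
    (hne : Q.Nonempty) (hQA : Q ≠ A) (hO : ∀ w, w ∈ O ↔ w ∈ A ∧ w ∉ Q) :
    1 ≤ ∑ u ∈ O, degIn G Q u := by
  obtain ⟨a, ha, b, hb, hbQ, hab⟩ := h.2 Q hQ hne hQA
  exact (SOrder.one_le_degIn ha hab.symm).trans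
    (Finset.single_le_sum (f := fun u => degIn G Q u) (fun _ _ => degIn_nonneg _ _)
      ((hO b).2 ⟨hb, hbQ⟩))

/-- A graph without cut vertices, of cyclomatic number `C(q, 2) + s` and minimum degree at least
`d`, has only one vertex outside a clique of size `q + 1`, if `s + 1 < d = q`, or if `d = s + 1` is
the degree of a vertex outside the clique whose neighbours are pairwise adjacent. -/
theorem card_of_clique {A Q : Finset V} {q s d : ℤ} (hA : ConnOn G A)
    (hcut : ∀ x ∈ A, ConnOn G (A.erase x)) (hQA : Q ⊆ A) (hQ : CliqueOn G Q)
    (hQcard : (Q.card : ℤ) = q + 1) (hs : 1 ≤ s) (hsq : s ≤ q)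
    (hw : walks2 G A + 2 = 2 * A.card + (q * (q - 1) + 2 * s))
    (hmin : ∀ u ∈ A, d ≤ degIn G A u) (hd2 : 2 ≤ d)
    (hcase : d = q ∧ s + 1 < q ∨ d = s + 1 ∧ ∃ v ∈ A, v ∉ Q ∧ degIn G A v = d ∧
      CliqueOn G (nbrs G A v)) :
    (A.card : ℤ) = q + 2 := by
  have hQne : Q.Nonempty := by rw [← Finset.card_pos]; omega
  set O := A \ Q with hO
  have hdisj : Disjoint Q O := Finset.disjoint_sdiff
  have hun : Q ∪ O = A := Finset.union_sdiff_of_subset hQA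
  have hcard : (A.card : ℤ) = q + 1 + O.card := by
    rw [← hun, Finset.card_union_of_disjoint hdisj]; push_cast; rw [hQcard]
  have h1 := walks2_union_eq (G := G) hdisj
  rw [hun, hQ.walks2_eq, hQcard] at h1
  set e := ∑ u ∈ O, degIn G Q u with he
  have hsum : ∑ u ∈ O, degIn G A u = e + walks2 G O := by
    rw [← hun, he, walks2, ← Finset.sum_add_distrib]
    exact Finset.sum_congr rfl fun u _ => degIn_union hdisj u
  have hge : (O.card : ℤ) * d ≤ e + walks2 G O := by
    rw [← hsum]
    have := Finset.card_nsmul_le_sum O (fun u => degIn G A u) d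
      (fun u hu => hmin u (Finset.mem_sdiff.1 hu).1)
    simpa using this
  have hO2 := walks2_le (G := G) O
  have hQA' : Q ≠ A := by
    rintro rfl
    have := hQ.walks2_eq
    rw [hQcard] at this hw
    nlinarith
  have he1 : 1 ≤ e := hA.one_le_sum_degIn hQA hQne hQA' (fun w => by simp [hO])
  have hk : 1 ≤ (O.card : ℤ) := by
    have : O.Nonempty := Finset.sdiff_nonempty.2 fun h => hQA' (hQA.antisymm h)
    exact_mod_cast this.card_pos
  generalize hkk : (O.card : ℤ) = k at *
  -- The clique accounts for C(q,2) of the cyclomatic number, so the k outside vertices carry k + s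
  -- edges in all, those to the clique included.
  have hdeg : 2 * e + walks2 G O = 2 * k + 2 * s := by nlinarith
  by_cases hk1 : k = 1
  · rw [hcard, hk1]; ring
  exfalso
  have hk2 : 2 ≤ k := by omega
  rcases hcase with ⟨rfl, hsd⟩ | ⟨rfl, v, hvA, hvQ, hvd, hvN⟩
  -- From k·d ≤ 2k + 2s - e, with e ≥ 1 and s ≤ d - 2.
  · have : (k - 2) * (d - 2) + 1 ≤ 0 := by nlinarith
    nlinarith [mul_nonneg (show 0 ≤ k - 2 by omega) (show 0 ≤ d - 2 by omega)]
  -- Minimum degree s + 1 forces many edges within `O`, and `O` has only k vertices to hold them;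
  -- together with e ≥ 1 this leaves s = 1.
  have b1 : 2 * s * (k - 1) ≤ walks2 G O := by nlinarith
  have b2 : 2 * s ≤ k := by nlinarith
  have b3 : (k - 2) * (s - 1) ≤ 1 := by nlinarith
  have hs1 : s = 1 := by
    by_contra hne
    have : 2 ≤ s := by omega
    nlinarith
  subst hs1
  -- the graph without `v` is the clique with trees attached
  set A' := A.erase v with hA'
  have hvO : v ∈ O := Finset.mem_sdiff.2 ⟨hvA, hvQ⟩
  have hQA1 : Q ⊆ A' := fun z hz =>
    Finset.mem_erase.2 ⟨fun e => hvQ (e ▸ hz), hQA hz⟩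
  set O' := O.erase v with hO'
  have hdisj' : Disjoint Q O' := hdisj.mono_right (Finset.erase_subset _ _)
  have hmemO' : ∀ w, w ∈ O' ↔ w ∈ A' ∧ w ∉ Q := by
    intro w; simp only [hO', hO, hA', Finset.mem_erase, Finset.mem_sdiff]; tauto
  have hun' : Q ∪ O' = A' := by
    ext w
    rw [Finset.mem_union, hmemO']
    have := @hQA1 w
    tauto
  have hvA' : v ∉ A' := by simp [hA']
  have hins : insert v A' = A := Finset.insert_erase hvA
  have hdv : degIn G A' v = 2 := by
    rw [← degIn_insert_self hvA', hins, hvd]; norm_num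
  have hA'2 := walks2_insert (G := G) hvA'
  rw [hins, hdv] at hA'2
  have h1' := walks2_union_eq (G := G) hdisj'
  rw [hun', hQ.walks2_eq, hQcard] at h1'
  set e' := ∑ u ∈ O', degIn G Q u with he'
  have hsum' : ∑ u ∈ O', degIn G A' u = e' + walks2 G O' := by
    rw [← hun', he', walks2, ← Finset.sum_add_distrib]
    exact Finset.sum_congr rfl fun u _ => degIn_union hdisj' u
  have hcardO' : (O'.card : ℤ) = k - 1 := by
    have : O'.card + 1 = O.card := Finset.card_erase_add_one hvO
    omega
  have hQA1' : Q ≠ A' := by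
    intro e
    have : O' = ∅ := by
      ext w; rw [hmemO', e]; simp
    rw [this] at hcardO'
    simp at hcardO'
    omega
  have he1' : 1 ≤ e' := (hcut v hvA).one_le_sum_degIn hQA1 hQne hQA1' hmemO'
  -- Without v there are only k - 1 edges for the k - 1 outside vertices, and at least one of them
  -- goes to the clique. So the average degree of these vertices is below 2 and one of them is at
  -- most a leaf.
  obtain ⟨u, hu, hult⟩ : ∃ u ∈ O', degIn G A' u < 2 := by
    apply Finset.exists_lt_of_sum_lt
    rw [hsum', Finset.sum_const, nsmul_eq_mul, hcardO']
    nlinarith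
  obtain ⟨huA', huQ⟩ := (hmemO' u).1 hu
  have hdu := hmin u (Finset.mem_of_mem_erase huA')
  rw [← hins, degIn_insert hvA'] at hdu
  have huv : G.Adj u v := by
    by_contra hn
    rw [adjInd_of_not_adj hn] at hdu
    omega
  have hN2 : (nbrs G A v).card = 2 := by
    have := card_nbrs (G := G) A v
    rw [hvd] at this
    omega
  have huN : u ∈ nbrs G A v := mem_nbrs.2 ⟨Finset.mem_of_mem_erase huA', huv.symm⟩
  obtain ⟨b, hb⟩ : ∃ b, (nbrs G A v).erase u = {b} := by
    rw [← Finset.card_eq_one, Finset.card_erase_of_mem huN, hN2]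
  have hbN : b ∈ (nbrs G A v).erase u := by rw [hb]; simp
  have hbu := Finset.ne_of_mem_erase hbN
  obtain ⟨hbA, hvb⟩ := mem_nbrs.1 (Finset.mem_of_mem_erase hbN)
  have hub : G.Adj u b := hvN u huN b (Finset.mem_of_mem_erase hbN) hbu.symm
  have hbA' : b ∈ A' := Finset.mem_erase.2 ⟨hvb.ne.symm, hbA⟩
  obtain ⟨z, hz⟩ : (Q.erase b).Nonempty := by
    rw [← Finset.card_pos]
    have := Finset.pred_card_le_card_erase (s := Q) (a := b)
    omega
  rw [Finset.mem_erase] at hz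
  -- The vertices u, v, b form a triangle in which u and v have no further neighbours, so b
  -- separates them from z: a cut vertex, which is excluded.
  obtain ⟨a, ha, y, hy, hyS, hay⟩ := (hcut b hbA).2 {u, v}
    (by
      intro w hw
      rw [Finset.mem_insert, Finset.mem_singleton] at hw
      rcases hw with rfl | rfl
      · exact Finset.mem_erase.2 ⟨hbu.symm, Finset.mem_of_mem_erase huA'⟩
      · exact Finset.mem_erase.2 ⟨hvb.ne, hvA⟩)
    (by simp)
    (by
      intro e
      have : z ∈ ({u, v} : Finset V) := by
        rw [e]; exact Finset.mem_erase.2 ⟨hz.1, hQA hz.2⟩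
      rw [Finset.mem_insert, Finset.mem_singleton] at this
      rcases this with rfl | rfl
      · exact huQ hz.2
      · exact hvQ hz.2)
  rw [Finset.mem_insert, Finset.mem_singleton, not_or] at hyS
  rw [Finset.mem_erase] at hy
  rw [Finset.mem_insert, Finset.mem_singleton] at ha
  rcases ha with rfl | rfl
  · have := two_le_degIn (A := A') (Finset.mem_erase.2 ⟨hyS.2, hy.2⟩) hbA' hy.1 hay hub
    omega
  · have : y ∈ (nbrs G A a).erase u :=
      Finset.mem_erase.2 ⟨hyS.1, mem_nbrs.2 ⟨hy.2, hay⟩⟩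
    rw [hb, Finset.mem_singleton] at this
    exact hy.1 this

end Structure

/-! ### The triangle bound with its equality cases, by induction on the vertex set -/

section Induction

variable {V : Type*} {G : SimpleGraph V}

/-- The parameters `r`, `t` belonging to the cyclomatic number `c`. -/
def CycleParams (c r t : ℤ) : Prop :=
  c = 0 ∧ r = 1 ∧ t = 1 ∨ 2 ≤ t ∧ t ≤ r ∧ 2 * c = (r - 1) * (r - 2) + 2 * (t - 1)

theorem CycleParams.cascade {c r t : ℤ} (h : CycleParams c r t) : Cascade c (r - 1) (t - 1) := by
  rcases h with ⟨rfl, rfl, rfl⟩ | ⟨h1, h2, h3⟩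
  · norm_num [Cascade]
  · exact ⟨by omega, by omega, by linarith⟩

theorem Cascade.nonneg {c q s : ℤ} (h : Cascade c q s) : 0 ≤ c := by
  obtain ⟨h0, h1, h2⟩ := h
  rcases (h0.trans h1).eq_or_lt with rfl | h
  · omega
  · nlinarith

theorem CycleParams.triMax_eq {c r t : ℤ} (h : CycleParams c r t) :
    triMax c = r * (r - 1) * (r - 2) + 3 * (t * (t - 1)) := by
  rw [h.cascade.triMax_eq, cascadeValue]; ring

theorem CycleParams.of_pos {c r t q s : ℤ} (h : CycleParams c r t) (hs : 1 ≤ s)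
    (h' : Cascade c q s) : r = q + 1 ∧ t = s + 1 := by
  have hc : c ≠ 0 := by
    rintro rfl
    obtain ⟨h0, h1, h2⟩ := h'
    nlinarith
  have ht : 2 ≤ t := by
    rcases h with h | h
    · exact absurd h.1 hc
    · exact h.1
  have := h.cascade.unique_of_pos h' (by omega) (by omega)
  omega

variable (G) in
/-- `A` has at most the number of triangles allowed by its cyclomatic number, and in case of
equality it is extremal or has too few closed walks of length four. -/
def TriangleBound (A : Finset V) : Prop :=
  ∃ c : ℤ, 0 ≤ c ∧ walks2 G A + 2 = 2 * A.card + 2 * c ∧ walks3 G A ≤ triMax c ∧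
    (walks3 G A = triMax c →
      (∀ q, 0 ≤ q → 2 * c = q * (q - 1) → ∃ Q ⊆ A, (Q.card : ℤ) = q + 1 ∧ CliqueOn G Q) ∧
      ∀ r t, CycleParams c r t → (∃ x, IsExtremal G A x r t) ∨
        walks4 G A < extremalWalks4 A.card r t ∧ 4 ≤ A.card ∧ (A.card = 4 → c = 0))

variable [DecidableEq V]

/-- Delete a vertex v of minimum degree. Equality in the bound forces equality for the remaining
graph, makes the neighbourhood of v a clique, and leaves the two values of d from `triMax_step`; in
both there is a clique on q + 1 vertices, so `card_of_clique` applies. -/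
theorem triangleBound_of_not_cut {A : Finset V} (hA : ConnOn G A) (hcard : 3 ≤ A.card)
    (hcut : ∀ x ∈ A, ConnOn G (A.erase x)) (ih : ∀ x ∈ A, TriangleBound G (A.erase x)) :
    TriangleBound G A := by
  obtain ⟨v, hv, hmin⟩ := Finset.exists_min_image A (degIn G A) hA.1
  have hd2 := two_le_degIn_of_not_cut hA hcard hcut hv
  set d := degIn G A v with hd
  obtain ⟨c', hc', hw2, hw3, heq'⟩ := ih v hv
  set A' := A.erase v with hA'
  have hvA' : v ∉ A' := by simp [hA']
  have hins : insert v A' = A := Finset.insert_erase hv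
  have hdv : degIn G A' v = d := by rw [← degIn_insert_self hvA', hins]
  have i2 := walks2_insert (G := G) hvA'
  have i3 := walks3_insert (G := G) hvA'
  rw [hins, hdv] at i2
  rw [hins] at i3
  have hcA : (A.card : ℤ) = A'.card + 1 := by
    rw [← hins, Finset.card_insert_of_notMem hvA']; push_cast; ring
  have hdle : d ≤ A'.card := hdv ▸ degIn_le_card A' v
  have hsum : (A.card : ℤ) * d ≤ walks2 G A := by
    have := Finset.card_nsmul_le_sum A (fun u => degIn G A u) d hmin
    rw [walks2]
    simpa using this
  obtain ⟨c, hc⟩ : ∃ c, c = c' + (d - 1) := ⟨_, rfl⟩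
  have hwA : walks2 G A + 2 = 2 * A.card + 2 * c := by rw [i2, hcA, hc]; linarith
  -- Here 2c ≥ |A|(d - 2) + 2 by summing degrees, and |A| ≥ d + 1.
  have hdc : d * (d - 1) ≤ 2 * c := by nlinarith
  obtain ⟨q, s, hs, hqs⟩ := exists_cascade_of_one_le (c := c) (by omega)
  have step := triMax_step hd2 hdc hqs hs
  rw [show c - (d - 1) = c' by rw [hc]; ring] at step
  have hN := walks2_le (G := G) (nbrs G A' v)
  rw [card_nbrs, hdv] at hN
  refine ⟨c, by omega, hwA, by linarith [step.1], fun heq => ?_⟩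
  have hw3' : walks3 G A' = triMax c' := by linarith [step.1]
  have hNc : CliqueOn G (nbrs G A' v) := cliqueOn_of_walks2 (by
    rw [card_nbrs, hdv]; linarith [step.1])
  have hNA : nbrs G A v = nbrs G A' v := by
    ext w
    simp only [mem_nbrs, hA', Finset.mem_erase]
    exact ⟨fun h => ⟨⟨h.2.ne.symm, h.1⟩, h.2⟩, fun h => ⟨h.1.2, h.2⟩⟩
  have hcases := step.2 (by linarith [step.1])
  obtain ⟨hs0, hsq, hcq⟩ := id hqs
  obtain ⟨Q, hQA, hQcard, hQ, hcase⟩ : ∃ Q ⊆ A, (Q.card : ℤ) = q + 1 ∧ CliqueOn G Q ∧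
      (d = q ∧ s + 1 < q ∨ d = s + 1 ∧ ∃ v ∈ A, v ∉ Q ∧ degIn G A v = d ∧
        CliqueOn G (nbrs G A v)) := by
    -- If d = s + 1, the remaining graph has cyclomatic number C(q,2) and the induction hypothesis
    -- supplies the clique. If d = q, it is v with its neighbours.
    rcases hcases with h | h
    · obtain ⟨Q, hQ, h1, h2⟩ := (heq' hw3').1 q (by omega) (by rw [h] at hc; linarith)
      exact ⟨Q, hQ.trans (Finset.erase_subset _ _), h1, h2, Or.inr ⟨h, v, hv,
        fun hvQ => hvA' (hQ hvQ), rfl, hNA ▸ hNc⟩⟩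
    · refine ⟨insert v (nbrs G A' v), ?_, ?_, hNc.insert_vertex fun w hw => (mem_nbrs.1 hw).2,
        Or.inl h⟩
      · rw [← hins]
        exact Finset.insert_subset_insert _ fun w hw => (mem_nbrs.1 hw).1
      · rw [Finset.card_insert_of_notMem fun h => hvA' (mem_nbrs.1 h).1]
        push_cast
        rw [card_nbrs, hdv, h.1]
  have hAcard := card_of_clique hA hcut hQA hQ hQcard hs hsq (by linarith) hmin hd2 hcase
  obtain ⟨w, hw⟩ : ∃ w, A \ Q = {w} := by
    rw [← Finset.card_eq_one]
    have := Finset.card_sdiff_add_card_eq_card hQA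
    omega
  have hwmem : w ∈ A \ Q := by rw [hw]; simp
  obtain ⟨hwA', hwQ⟩ := Finset.mem_sdiff.1 hwmem
  have hAQ : insert w Q = A := by
    rw [Finset.insert_eq, ← hw, Finset.sdiff_union_of_subset hQA]
  have hdw : degIn G Q w = s + 1 := by
    have := walks2_insert (G := G) hwQ
    rw [hAQ, hQ.walks2_eq, hQcard] at this
    nlinarith
  refine ⟨fun p hp hcp => ?_, fun r t hrt => Or.inl ?_⟩
  -- Since s ≥ 1, a representation C(p,2) means s = q and p = q + 1, and then the whole set is the
  -- clique.
  · have hpq : q < p := by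
      by_contra hle
      nlinarith
    have hsq' := hqs.lt_or (q' := p) (s' := 0) ⟨le_rfl, by omega, by linarith⟩ hpq
    refine ⟨A, subset_rfl, by rw [hAcard, hsq'.2.1]; ring, ?_⟩
    rw [← hAQ]
    exact hQ.insert_vertex (adj_of_degIn_eq_card (by rw [hdw, hQcard, hsq'.1]))
  · obtain ⟨rfl, rfl⟩ := hrt.of_pos hs hqs
    obtain ⟨x, hx⟩ : (nbrs G Q w).Nonempty := by
      rw [← Finset.card_pos]
      have := card_nbrs (G := G) Q w
      omega
    rw [mem_nbrs] at hx
    refine ⟨x, Q, w, hQA, hwA', hwQ, hx.1, hQcard, hQ, hdw, hx.2, fun z hz hzQ hzw => ?_⟩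
    rw [← hAQ, Finset.mem_insert] at hz
    tauto

/-- Gluing a tree to `insert x D` at `x`. -/
theorem triangleBound_glue_tree {D E : Finset V} {x : V} (hD : D.Nonempty) (hE : E.Nonempty)
    (hDE : Disjoint D E) (hxD : x ∉ D) (hxE : x ∉ E) (hno : ∀ u ∈ D, ∀ w ∈ E, ¬ G.Adj u w)
    (hcD : ConnOn G (insert x D)) (hcE : ConnOn G (insert x E)) {c : ℤ}
    (hB2 : walks2 G (insert x D) + 2 = 2 * (insert x D).card + 2 * c)
    (hB4 : ∀ r t, CycleParams c r t → (∃ x', IsExtremal G (insert x D) x' r t) ∨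
      walks4 G (insert x D) < extremalWalks4 (insert x D).card r t ∧ 4 ≤ (insert x D).card ∧
        ((insert x D).card = 4 → c = 0))
    (hC2 : walks2 G (insert x E) + 2 = 2 * (insert x E).card)
    (hC4 : (∃ x', IsExtremal G (insert x E) x' 1 1) ∨
      walks4 G (insert x E) < extremalWalks4 (insert x E).card 1 1 ∧ 4 ≤ (insert x E).card)
    {r t : ℤ} (hrt : CycleParams c r t) :
    (∃ x', IsExtremal G (insert x (D ∪ E)) x' r t) ∨
      walks4 G (insert x (D ∪ E)) < extremalWalks4 (insert x (D ∪ E)).card r t ∧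
        4 ≤ (insert x (D ∪ E)).card ∧ ((insert x (D ∪ E)).card = 4 → c = 0) := by
  have hxU : x ∉ D ∪ E := by simp [hxD, hxE]
  have kB : (insert x D).card = D.card + 1 := Finset.card_insert_of_notMem hxD
  have kC : (insert x E).card = E.card + 1 := Finset.card_insert_of_notMem hxE
  have kA : (insert x (D ∪ E)).card = D.card + E.card + 1 := by
    rw [Finset.card_insert_of_notMem hxU, Finset.card_union_of_disjoint hDE]
  have pD := hD.card_pos
  have pE := hE.card_pos
  have dD1 : 1 ≤ degIn G D x := by
    rw [← degIn_insert_self hxD]; exact hcD.one_le_degIn (by simp) (by omega)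
  have dE1 : 1 ≤ degIn G E x := by
    rw [← degIn_insert_self hxE]; exact hcE.one_le_degIn (by simp) (by omega)
  have dD := degIn_le_card (G := G) D x
  have dE := degIn_le_card (G := G) E x
  have g4 := walks4_glue hDE hno hxD hxE
  -- Adding pendant edges at a dominating vertex keeps the shape, so the extremal values satisfy the
  -- gluing formula with full degrees. Any missing neighbour of x therefore makes the count strictly
  -- smaller.
  have hsum : extremalWalks4 (insert x D).card r t + extremalWalks4 (insert x E).card 1 1 +
      4 * (D.card * E.card) = extremalWalks4 (insert x (D ∪ E)).card r t := by
    rw [kA, kB, kC]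
    simp only [extremalWalks4, coreWalks4]
    push_cast
    ring
  have hprod : degIn G D x * degIn G E x ≤ D.card * E.card :=
    mul_le_mul dD dE (by omega) (by omega)
  have hB4' : walks4 G (insert x D) ≤ extremalWalks4 (insert x D).card r t := by
    rcases hB4 r t hrt with ⟨x', h⟩ | h
    · exact h.walks.2.2.le
    · exact h.1.le
  have hC4' : walks4 G (insert x E) ≤ extremalWalks4 (insert x E).card 1 1 := by
    rcases hC4 with ⟨x', h⟩ | h
    · exact h.walks.2.2.le
    · exact h.1.le
  rcases hB4 r t hrt with ⟨x₁, h₁⟩ | h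
  swap
  · exact Or.inr ⟨by linarith [h.1], by omega, by omega⟩
  rcases hC4 with ⟨x₂, h₂⟩ | h
  swap
  · exact Or.inr ⟨by linarith [h.1], by omega, by omega⟩
  rcases dD.lt_or_eq with hlt | hDfull
  -- With four vertices in all, D has two; c > 0 would make D with x a triangle, in which x misses
  -- nobody.
  · refine Or.inr ⟨by nlinarith, by omega, fun h4 => ?_⟩
    have hk : D.card = 2 := by omega
    have := walks2_le (G := G) (insert x D)
    rw [kB, hk] at this hB2
    push_cast at this hB2
    have h0 := h₁.walks
    have hc0 : 0 ≤ c := hrt.cascade.nonneg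
    by_contra hne
    have h6 : walks2 G (insert x D) = (insert x D).card * ((insert x D).card - 1) := by
      rw [kB, hk]; push_cast; omega
    have hcl := cliqueOn_of_walks2 h6
    have : degIn G D x = D.card := degIn_eq_card fun w hw =>
      hcl x (by simp) w (by simp [hw]) fun e => hxD (e ▸ hw)
    omega
  rcases dE.lt_or_eq with hlt | hEfull
  · refine Or.inr ⟨by nlinarith, by omega, fun h4 => ?_⟩
    have hk : D.card = 1 := by omega
    have := walks2_le (G := G) (insert x D)
    rw [kB, hk] at this hB2
    push_cast at this hB2
    have hc0 : 0 ≤ c := hrt.cascade.nonneg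
    omega
  left
  have aD := adj_of_degIn_eq_card hDfull
  have aE := adj_of_degIn_eq_card hEfull
  have h₁' := h₁.change (y := x) (by simp) fun w hw hwx =>
    aD w ((Finset.mem_insert.1 hw).resolve_left hwx)
  -- The edges at x already exhaust the edges of the tree.
  have hind : ∀ u ∈ E, ∀ w ∈ E, ¬ G.Adj u w := by
    have h0 : walks2 G E = 0 := by
      have := walks2_insert (G := G) hxE
      rw [hEfull] at this
      rw [kC] at hC2
      push_cast at hC2
      linarith
    intro u hu w hw huw
    have h1 := one_le_degIn hw huw
    have h2 := Finset.single_le_sum (f := fun u => degIn G E u) (fun _ _ => degIn_nonneg _ _) hu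
    rw [walks2] at h0
    omega
  refine ⟨x, h₁'.extend (Finset.insert_subset_insert _ Finset.subset_union_left) ?_⟩
  intro w hw hwB u hu
  simp only [Finset.mem_insert, Finset.mem_union, not_or] at hw hwB hu
  have hwE : w ∈ E := by tauto
  refine ⟨fun hwu => ?_, fun e => e ▸ (aE w hwE).symm⟩
  rcases hu with hu | hu | hu
  · exact hu
  · exact absurd hwu.symm (hno u hu w hwE)
  · exact absurd hwu (hind w hwE u hu)

/-- Superadditivity of `triMax` gives the bound. For c₂ > 0, equality leaves only c₂ = 1 and c₁ =
C(q,2), and then the closed 4-walks fall short. -/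
theorem triangleBound_glue {D E : Finset V} {x : V} (hD : D.Nonempty) (hE : E.Nonempty)
    (hDE : Disjoint D E) (hxD : x ∉ D) (hxE : x ∉ E) (hno : ∀ u ∈ D, ∀ w ∈ E, ¬ G.Adj u w)
    (hcD : ConnOn G (insert x D)) (hcE : ConnOn G (insert x E))
    {c₁ c₂ : ℤ} (hc₁ : 0 ≤ c₁) (hc₂ : 0 ≤ c₂) (hle : c₂ ≤ c₁)
    (hB2 : walks2 G (insert x D) + 2 = 2 * (insert x D).card + 2 * c₁)
    (hC2 : walks2 G (insert x E) + 2 = 2 * (insert x E).card + 2 * c₂)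
    (hB3 : walks3 G (insert x D) ≤ triMax c₁) (hC3 : walks3 G (insert x E) ≤ triMax c₂)
    (hB : walks3 G (insert x D) = triMax c₁ →
      (∀ q, 0 ≤ q → 2 * c₁ = q * (q - 1) →
        ∃ Q ⊆ insert x D, (Q.card : ℤ) = q + 1 ∧ CliqueOn G Q) ∧
      ∀ r t, CycleParams c₁ r t → (∃ x', IsExtremal G (insert x D) x' r t) ∨
        walks4 G (insert x D) < extremalWalks4 (insert x D).card r t ∧ 4 ≤ (insert x D).card ∧
          ((insert x D).card = 4 → c₁ = 0))
    (hC : walks3 G (insert x E) = triMax c₂ →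
      ∀ r t, CycleParams c₂ r t → (∃ x', IsExtremal G (insert x E) x' r t) ∨
        walks4 G (insert x E) < extremalWalks4 (insert x E).card r t ∧ 4 ≤ (insert x E).card ∧
          ((insert x E).card = 4 → c₂ = 0)) :
    TriangleBound G (insert x (D ∪ E)) := by
  have hxU : x ∉ D ∪ E := by simp [hxD, hxE]
  have kB : (insert x D).card = D.card + 1 := Finset.card_insert_of_notMem hxD
  have kC : (insert x E).card = E.card + 1 := Finset.card_insert_of_notMem hxE
  have kA : (insert x (D ∪ E)).card = D.card + E.card + 1 := by
    rw [Finset.card_insert_of_notMem hxU, Finset.card_union_of_disjoint hDE]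
  have g2 := walks2_glue hDE hno hxD hxE
  have g3 := walks3_glue hDE hno hxD hxE
  have hw2 : walks2 G (insert x (D ∪ E)) + 2 =
      2 * (insert x (D ∪ E)).card + 2 * (c₁ + c₂) := by
    rw [kB] at hB2
    rw [kC] at hC2
    rw [g2, kA]
    push_cast at hB2 hC2 ⊢
    linarith
  rcases hc₂.eq_or_lt with rfl | hpos
  · refine ⟨c₁ + 0, by omega, hw2, ?_, ?_⟩
    · rw [add_zero]; rw [triMax_zero] at hC3; linarith
    · rw [add_zero]
      intro he
      rw [triMax_zero] at hC3
      have e1 : walks3 G (insert x D) = triMax c₁ := by linarith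
      have e2 : walks3 G (insert x E) = triMax 0 := by rw [triMax_zero]; linarith
      refine ⟨fun q hq hcq => ?_, fun r t hrt => ?_⟩
      · obtain ⟨Q, hQ, h⟩ := (hB e1).1 q hq hcq
        exact ⟨Q, hQ.trans (Finset.insert_subset_insert _ Finset.subset_union_left), h⟩
      · refine triangleBound_glue_tree hD hE hDE hxD hxE hno hcD hcE hB2 (hB e1).2
          (by linarith) ?_ hrt
        rcases hC e2 1 1 (Or.inl ⟨rfl, rfl, rfl⟩) with h | h
        · exact Or.inl h
        · exact Or.inr ⟨h.1, h.2.1⟩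
  · have hadd := triMax_add (c₁ := c₁) (c₂ := c₂) (by omega) hle
    refine ⟨c₁ + c₂, by omega, hw2, by linarith [hadd.1], fun he => ?_⟩
    have e1 : walks3 G (insert x D) = triMax c₁ := by linarith [hadd.1]
    have e2 : walks3 G (insert x E) = triMax c₂ := by linarith [hadd.1]
    obtain ⟨rfl, q, hq, hcq⟩ := hadd.2 (by linarith)
    refine ⟨fun p hp hcp => ?_, fun r t hrt => Or.inr ?_⟩
    -- C(q,2) + 1 lies strictly between C(q,2) and C(q+1,2), because q ≥ 2.
    · exfalso
      rcases le_or_gt p q with h | h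
      · nlinarith
      · have : q + 1 ≤ p := h
        nlinarith
    obtain ⟨rfl, rfl⟩ := hrt.of_pos (q := q) (s := 1) le_rfl ⟨by omega, by omega, by linarith⟩
    have card_ge : ∀ (B : Finset V) (c : ℤ), 1 ≤ c → walks2 G B + 2 = 2 * B.card + 2 * c →
        1 ≤ B.card → 3 ≤ B.card := by
      intro B c hc h hB1
      have := walks2_le (G := G) B
      by_contra hlt
      have h3 : B.card ≤ 2 := by omega
      have hB : B.card = 1 ∨ B.card = 2 := by omega
      rcases hB with e | e <;> rw [e] at this h <;> norm_num at this h <;> omega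
    have n1 := card_ge _ _ (by omega) hB2 (by omega)
    have n2 := card_ge _ _ (by omega) hC2 (by omega)
    refine ⟨?_, by omega, by omega⟩
    have hB4' : walks4 G (insert x D) ≤ extremalWalks4 (insert x D).card q q := by
      rcases (hB e1).2 q q (Or.inr ⟨hq, le_rfl, by linarith⟩) with ⟨x', h⟩ | h
      · exact h.walks.2.2.le
      · exact h.1.le
    have hC4' : walks4 G (insert x E) ≤ extremalWalks4 (insert x E).card 2 2 := by
      rcases hC e2 2 2 (Or.inr ⟨le_rfl, le_rfl, by norm_num⟩) with ⟨x', h⟩ | h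
      · exact h.walks.2.2.le
      · exact h.1.le
    have hprod : degIn G D x * degIn G E x ≤ D.card * E.card :=
      mul_le_mul (degIn_le_card _ _) (degIn_le_card _ _) (degIn_nonneg _ _) (by omega)
    -- Even with x adjacent to everything in both pieces the deficit is 12(q - 1) > 0.
    have key : extremalWalks4 (insert x D).card q q + extremalWalks4 (insert x E).card 2 2 +
        4 * (D.card * E.card) + 12 * (q - 1) =
        extremalWalks4 (insert x (D ∪ E)).card (q + 1) (1 + 1) := by
      rw [kA, kB, kC]
      simp only [extremalWalks4, coreWalks4]
      push_cast
      ring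
    rw [walks4_glue hDE hno hxD hxE]
    linarith

theorem triangleBound_two {A : Finset V} (hA : ConnOn G A) (hcard : A.card = 2) :
    TriangleBound G A := by
  obtain ⟨a, b, hab, rfl⟩ := Finset.card_eq_two.1 hcard
  have hadj : G.Adj a b := by
    obtain ⟨a', ha', b', hb', hb'S, h⟩ := hA.2 {a} (by simp) (by simp) (by
      intro e
      rw [← e] at hcard
      simp at hcard)
    simp only [Finset.mem_singleton, Finset.mem_insert] at ha' hb' hb'S
    subst ha'
    rcases hb' with rfl | rfl
    · exact absurd rfl hb'S
    · exact h
  have hex : IsExtremal G {a, b} a 1 1 := by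
    refine ⟨{a}, b, by simp, by simp, by simpa using hab.symm, by simp, by simp, ?_, ?_,
      hadj.symm, ?_⟩
    · intro u hu w hw huw
      simp only [Finset.mem_singleton] at hu hw
      exact absurd (hu.trans hw.symm) huw
    · simp [degIn, adjInd_of_adj hadj.symm]
    · intro w hw hwa hwb
      simp only [Finset.mem_insert, Finset.mem_singleton] at hw hwa
      tauto
  obtain ⟨w2, w3, -⟩ := hex.walks
  rw [hcard] at w2
  refine ⟨0, le_rfl, by rw [w2, hcard]; norm_num, by rw [w3, triMax_zero]; norm_num, fun _ =>
    ⟨fun q hq h => ?_, fun r t hrt => Or.inl ?_⟩⟩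
  · have : q = 0 ∨ q = 1 := by
      have : q * (q - 1) = 0 := by linarith
      rcases mul_eq_zero.1 this with h | h <;> omega
    rcases this with rfl | rfl
    · exact ⟨{a}, by simp, by simp, fun u hu w hw huw => by
        simp only [Finset.mem_singleton] at hu hw
        exact absurd (hu.trans hw.symm) huw⟩
    · refine ⟨{a, b}, subset_rfl, by rw [hcard]; norm_num, ?_⟩
      apply cliqueOn_of_walks2
      rw [w2, hcard]
      norm_num
  · rcases hrt with ⟨-, rfl, rfl⟩ | ⟨h1, h2, h3⟩
    · exact ⟨a, hex⟩
    · nlinarith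

theorem triangleBound (n : ℕ) : ∀ A : Finset V, A.card = n → 2 ≤ n → ConnOn G A →
    TriangleBound G A := by
  induction n using Nat.strong_induction_on with
  | _ n ih =>
    intro A hn h2 hA
    rcases h2.eq_or_lt with h | h3
    · exact triangleBound_two hA (by omega)
    by_cases hcut : ∀ x ∈ A, ConnOn G (A.erase x)
    · refine triangleBound_of_not_cut hA (by omega) hcut fun x hx => ?_
      have := Finset.card_erase_of_mem hx
      exact ih (n - 1) (by omega) _ (by omega) (by omega) (hcut x hx)
    · push Not at hcut
      obtain ⟨x, hx, hnc⟩ := hcut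
      obtain ⟨D, E, hD, hE, hDE, hxD, hxE, hno, rfl, hcD, hcE⟩ :=
        hA.exists_glue hx (by omega) hnc
      have kB : (insert x D).card = D.card + 1 := Finset.card_insert_of_notMem hxD
      have kC : (insert x E).card = E.card + 1 := Finset.card_insert_of_notMem hxE
      have kA : (insert x (D ∪ E)).card = D.card + E.card + 1 := by
        rw [Finset.card_insert_of_notMem (by simp [hxD, hxE]), Finset.card_union_of_disjoint hDE]
      have pD := hD.card_pos
      have pE := hE.card_pos
      obtain ⟨c₁, hc₁, hB2, hB3, hB⟩ := ih _ (by omega) (insert x D) rfl (by omega) hcD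
      obtain ⟨c₂, hc₂, hC2, hC3, hC⟩ := ih _ (by omega) (insert x E) rfl (by omega) hcE
      rcases le_total c₂ c₁ with hle | hle
      · exact triangleBound_glue hD hE hDE hxD hxE hno hcD hcE hc₁ hc₂ hle hB2 hC2 hB3 hC3 hB
          fun h => (hC h).2
      · rw [Finset.union_comm]
        exact triangleBound_glue hE hD hDE.symm hxE hxD (fun u hu w hw h => hno w hw u hu h.symm)
          hcE hcD hc₂ hc₁ hle hC2 hB2 hC3 hB3 hC fun h => (hB h).2

end Induction

/-! ### Spectral moments as closed walk counts -/

section Moments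

variable {V W : Type*} [Fintype V] [Fintype W]

open Classical in
theorem spectralMoment_eq_trace (G : SimpleGraph V) (j : ℕ) :
    spectralMoment G j = ((G.adjMatrix ℝ) ^ j).trace := by
  have h := adjMatrix_isHermitian G
  rw [spectralMoment]
  conv_rhs => rw [h.spectral_theorem, ← map_pow, Unitary.conjStarAlgAut_apply,
    Matrix.trace_mul_cycle, Unitary.coe_star_mul_self, one_mul, Matrix.diagonal_pow,
    Matrix.trace_diagonal]
  simp

theorem spectralMoment_zero (G : SimpleGraph V) : spectralMoment G 0 = Fintype.card V := by
  simp [spectralMoment]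

theorem spectralMoment_one (G : SimpleGraph V) : spectralMoment G 1 = 0 := by
  classical
  rw [spectralMoment_eq_trace, pow_one]
  convert SimpleGraph.trace_adjMatrix ℝ G

omit [Fintype V] in
open Classical in
theorem adjMatrix_apply_eq_adjInd (G : SimpleGraph V) (u v : V) :
    G.adjMatrix ℝ u v = (adjInd G u v : ℝ) := by
  simp [SimpleGraph.adjMatrix_apply, adjInd]

theorem spectralMoment_two (G : SimpleGraph V) :
    spectralMoment G 2 = (walks2 G Finset.univ : ℝ) := by
  classical
  rw [spectralMoment_eq_trace, pow_two, Matrix.trace, walks2]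
  push_cast
  refine Finset.sum_congr rfl fun u _ => ?_
  rw [Matrix.diag_apply, Matrix.mul_apply, degIn]
  push_cast
  refine Finset.sum_congr rfl fun w _ => ?_
  rw [adjMatrix_apply_eq_adjInd, adjMatrix_apply_eq_adjInd, adjInd_comm w u]
  exact_mod_cast adjInd_sq u w

open Classical in
theorem adjMatrix_sq_apply (G : SimpleGraph V) (u v : V) :
    (G.adjMatrix ℝ * G.adjMatrix ℝ) u v = (codegIn G Finset.univ u v : ℝ) := by
  rw [Matrix.mul_apply, codegIn]
  push_cast
  exact Finset.sum_congr rfl fun w _ => by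
    rw [adjMatrix_apply_eq_adjInd, adjMatrix_apply_eq_adjInd]

theorem spectralMoment_three (G : SimpleGraph V) :
    spectralMoment G 3 = (walks3 G Finset.univ : ℝ) := by
  classical
  rw [spectralMoment_eq_trace, pow_succ, pow_two, Matrix.trace, walks3]
  push_cast
  refine Finset.sum_congr rfl fun u _ => ?_
  rw [Matrix.diag_apply, Matrix.mul_apply, Finset.sum_comm]
  refine Finset.sum_congr rfl fun w _ => ?_
  rw [adjMatrix_sq_apply, adjMatrix_apply_eq_adjInd, codegIn]
  push_cast
  rw [Finset.sum_mul]

theorem spectralMoment_four (G : SimpleGraph V) :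
    spectralMoment G 4 = (walks4 G Finset.univ : ℝ) := by
  classical
  rw [spectralMoment_eq_trace, show 4 = 2 + 2 from rfl, pow_add, pow_two, Matrix.trace, walks4]
  push_cast
  refine Finset.sum_congr rfl fun u _ => ?_
  rw [Matrix.diag_apply, Matrix.mul_apply]
  refine Finset.sum_congr rfl fun w _ => ?_
  rw [adjMatrix_sq_apply, adjMatrix_sq_apply, codegIn_comm _ w u, pow_two]

theorem spectralMoment_congr {G : SimpleGraph V} {H : SimpleGraph W} (e : G ≃g H) (j : ℕ) :
    spectralMoment G j = spectralMoment H j := by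
  classical
  have h : G.adjMatrix ℝ = Matrix.reindexAlgEquiv ℝ ℝ e.toEquiv.symm (H.adjMatrix ℝ) := by
    ext u v
    simp only [Matrix.coe_reindexAlgEquiv, Matrix.reindex_apply, Matrix.submatrix_apply,
      SimpleGraph.adjMatrix_apply, Equiv.symm_symm]
    exact if_congr e.map_adj_iff.symm rfl rfl
  rw [spectralMoment_eq_trace, spectralMoment_eq_trace]
  have h2 : ((G.adjMatrix ℝ) ^ j).trace =
      (Matrix.reindexAlgEquiv ℝ ℝ e.toEquiv.symm ((H.adjMatrix ℝ) ^ j)).trace := by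
    rw [map_pow, ← h]
  convert h2 using 1
  simp only [Matrix.trace, Matrix.diag_apply, Matrix.coe_reindexAlgEquiv, Matrix.reindex_apply,
    Matrix.submatrix_apply]
  exact (Equiv.sum_comp e.toEquiv fun i => (H.adjMatrix ℝ ^ j) i i).symm

theorem walks2_univ_eq (G : SimpleGraph V) : walks2 G Finset.univ = 2 * G.edgeSet.ncard := by
  classical
  have h := G.sum_degrees_eq_twice_card_edges
  rw [Set.ncard_eq_toFinset_card', SimpleGraph.edgeFinset] at *
  rw [walks2]
  have h2 : ∀ u, degIn G Finset.univ u = G.degree u := by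
    intro u
    rw [degIn_eq_card_filter, ← SimpleGraph.card_neighborFinset_eq_degree]
    congr 2
    ext w
    simp
  simp only [h2]
  exact_mod_cast h

theorem connOn_univ {G : SimpleGraph V} (h : G.Connected) : ConnOn G Finset.univ := by
  have := h.nonempty
  refine ⟨Finset.univ_nonempty, fun S _ ⟨a, ha⟩ hne => ?_⟩
  obtain ⟨b, hb⟩ : ∃ b, b ∉ S := by
    by_contra hall
    push Not at hall
    exact hne (Finset.eq_univ_iff_forall.2 hall)
  obtain ⟨p⟩ := h.preconnected a b
  obtain ⟨d, -, h1, h2⟩ := p.exists_boundary_dart (S : Set V) ha hb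
  exact ⟨d.fst, h1, d.snd, Finset.mem_univ _, h2, d.adj⟩

theorem IsExtremal.connected {G : SimpleGraph V} {x : V} {r t : ℤ}
    (h : IsExtremal G Finset.univ x r t) : G.Connected := by
  rw [SimpleGraph.connected_iff_exists_forall_reachable]
  refine ⟨x, fun w => ?_⟩
  by_cases hw : w = x
  · rw [hw]
  · exact (h.adj w (Finset.mem_univ _) hw).reachable

end Moments

/-! ### The extremal configuration is K_r^t with pendant edges, up to isomorphism -/

section Isomorphism

theorem IsExtremal.map {V W : Type*} {G : SimpleGraph V} {H : SimpleGraph W} (f : G ↪g H)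
    {A : Finset V} {x : V} {r t : ℤ} (h : IsExtremal G A x r t) :
    IsExtremal H (A.map f.toEmbedding) (f x) r t := by
  obtain ⟨Q, v, hQA, hvA, hvQ, hxQ, hr, hQ, ht, hvx, hP⟩ := h
  have hadj : ∀ a b, H.Adj (f a) (f b) ↔ G.Adj a b := fun a b => f.map_adj_iff
  refine ⟨Q.map f.toEmbedding, f v, Finset.map_subset_map.2 hQA, ?_, ?_, ?_, by simpa, ?_, ?_,
    (hadj _ _).2 hvx, ?_⟩
  · exact Finset.mem_map_of_mem _ hvA
  · exact fun h => hvQ ((Finset.mem_map' _).1 h)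
  · exact Finset.mem_map_of_mem _ hxQ
  · intro a ha b hb hab
    obtain ⟨a, ha', rfl⟩ := Finset.mem_map.1 ha
    obtain ⟨b, hb', rfl⟩ := Finset.mem_map.1 hb
    exact (hadj _ _).2 (hQ a ha' b hb' fun e => hab (by rw [e]))
  · rw [← ht, degIn, Finset.sum_map]
    refine Finset.sum_congr rfl fun w _ => ?_
    by_cases h : G.Adj v w
    · rw [adjInd_of_adj h]; exact adjInd_of_adj ((hadj _ _).2 h)
    · rw [adjInd_of_not_adj h]; exact adjInd_of_not_adj fun h' => h ((hadj _ _).1 h')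
  · intro w hw hwQ hwv u hu
    obtain ⟨w, hw', rfl⟩ := Finset.mem_map.1 hw
    obtain ⟨u, hu', rfl⟩ := Finset.mem_map.1 hu
    refine (hadj w u).trans ((hP w hw' (fun h => hwQ (Finset.mem_map_of_mem _ h))
      (fun e => hwv (by rw [e]; rfl)) u hu').trans ?_)
    exact f.injective.eq_iff.symm

theorem isExtremal_cliqueJoin {r t : ℕ} (ht : 1 ≤ t) (htr : t ≤ r) :
    IsExtremal (cliqueJoin r t) Finset.univ (some ⟨0, by omega⟩) r t := by
  refine ⟨Finset.univ.map Function.Embedding.some, none, Finset.subset_univ _, Finset.mem_univ _,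
    by simp, by simp, by simp, ?_, ?_, ?_, ?_⟩
  · intro a ha b hb hab
    obtain ⟨a, -, rfl⟩ := Finset.mem_map.1 ha
    obtain ⟨b, -, rfl⟩ := Finset.mem_map.1 hb
    exact fun e => hab (by rw [e])
  · rw [degIn, Finset.sum_map]
    have : ∀ i : Fin r, adjInd (cliqueJoin r t) none (Function.Embedding.some i) =
        if i.val < t then 1 else 0 := by
      intro i
      split_ifs with h
      · exact adjInd_of_adj h
      · exact adjInd_of_not_adj h
    simp only [this]
    rw [Finset.sum_boole, Fin.card_filter_val_lt, min_eq_right htr]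
  · show 0 < t
    omega
  · rintro (_ | w) _ hwQ hwv
    · exact absurd rfl hwv
    · simp at hwQ

open Classical in
theorem adj_of_degree_eq {V : Type*} [Fintype V] {G : SimpleGraph V} {v : V}
    (h : G.degree v + 1 = Fintype.card V) : ∀ w, w ≠ v → G.Adj v w := by
  have hsub : G.neighborFinset v ⊆ Finset.univ.erase v := fun w hw =>
    Finset.mem_erase.2 ⟨((G.mem_neighborFinset v w).1 hw).ne.symm, Finset.mem_univ _⟩
  have heq := Finset.eq_of_subset_of_card_le hsub (by
    rw [Finset.card_erase_of_mem (Finset.mem_univ _), Finset.card_univ,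
      SimpleGraph.card_neighborFinset_eq_degree]
    omega)
  intro w hw
  rw [← SimpleGraph.mem_neighborFinset, heq]
  simp [hw]

/-- By symmetry one dominating vertex of K_r^t is as good as another: `IsExtremal.change` moves the
distinguished vertex to v before the pendant edges are added. So the choice of v does not affect the
resulting graph. -/
theorem isExtremal_addPendant {r t p : ℕ} (ht : 1 ≤ t) (htr : t ≤ r) {v : Option (Fin r)}
    (hv : ∀ w, w ≠ v → (cliqueJoin r t).Adj v w) :
    IsExtremal (addPendant (cliqueJoin r t) v p) Finset.univ (Sum.inl v) r t := by
  classical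
  have h := (isExtremal_cliqueJoin ht htr).change (Finset.mem_univ v) fun w _ hw => hv w hw
  let f : cliqueJoin r t ↪g addPendant (cliqueJoin r t) v p :=
    ⟨Function.Embedding.inl, Iff.rfl⟩
  refine (h.map f).extend (Finset.subset_univ _) ?_
  rintro (w | w) - hw (u | u) -
  · exact absurd (Finset.mem_map_of_mem f.toEmbedding (Finset.mem_univ w)) hw
  · exact absurd (Finset.mem_map_of_mem f.toEmbedding (Finset.mem_univ w)) hw
  · show u = v ↔ (Sum.inl u : Option (Fin r) ⊕ Fin p) = Sum.inl v
    simp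
  · show False ↔ (Sum.inr u : Option (Fin r) ⊕ Fin p) = Sum.inl v
    simp

theorem IsCliqueWithPendants.isExtremal {n r t : ℕ} {G : SimpleGraph (Fin n)} (ht : 1 ≤ t)
    (htr : t ≤ r) (h : IsCliqueWithPendants n r t G) :
    ∃ x, IsExtremal G Finset.univ x r t := by
  classical
  obtain ⟨v, hv, ⟨e⟩⟩ := h
  have h1 := isExtremal_addPendant (p := n - r - 1) ht htr (v := v)
    (adj_of_degree_eq (by rw [hv]; simp))
  have h2 := h1.map e.symm.toEmbedding
  have hu : Finset.univ.map e.symm.toEmbedding.toEmbedding = Finset.univ :=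
    Finset.eq_univ_iff_forall.2 fun w =>
      Finset.mem_map.2 ⟨e w, Finset.mem_univ _, e.symm_apply_apply w⟩
  exact ⟨_, hu ▸ h2⟩

/-- Numbers the clique so that the t neighbours of the extra vertex come first and x gets number 0,
as in the standard model of K_r^t. -/
theorem exists_equiv_of_filter {α : Type*} {r t : ℕ} (ht : 1 ≤ t) (htr : t ≤ r)
    (e₀ : Fin r ≃ α) (p : α → Prop) (hp : Nat.card {a // p a} = t) {x : α} (hx : p x) :
    ∃ e : Fin r ≃ α, (∀ i, p (e i) ↔ i.val < t) ∧ e ⟨0, by omega⟩ = x := by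
  classical
  have : Finite α := Finite.of_equiv _ e₀
  have hc : Nat.card {i : Fin r // i.val < t} = Nat.card {i : Fin r // p (e₀ i)} := by
    rw [Nat.card_congr (e₀.subtypeEquiv (p := fun i => p (e₀ i)) (q := p) fun _ => Iff.rfl), hp,
      Nat.card_eq_fintype_card, Fintype.card_subtype, Fin.card_filter_val_lt, min_eq_right htr]
  obtain ⟨g⟩ := (Finite.card_eq).1 hc
  set σ := g.extendSubtype with hσ
  have hσp : ∀ i, p (e₀ (σ i)) ↔ i.val < t := by
    intro i
    by_cases hi : i.val < t
    · exact ⟨fun _ => hi, fun _ => g.extendSubtype_mem i hi⟩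
    · exact ⟨fun h => absurd h (g.extendSubtype_not_mem i hi), fun h => absurd h hi⟩
  set z : Fin r := ⟨0, by omega⟩
  set j := σ.symm (e₀.symm x) with hj
  have hjt : j.val < t := by
    rw [← hσp, hj]; simpa using hx
  -- Both 0 and the current number of x are below t, so exchanging them preserves the first
  -- property.
  refine ⟨(Equiv.swap z j).trans (σ.trans e₀), fun i => ?_, ?_⟩
  · show p (e₀ (σ (Equiv.swap z j i))) ↔ _
    rw [hσp]
    by_cases h1 : i = z
    · rw [h1, Equiv.swap_apply_left]
      exact ⟨fun _ => ht, fun _ => hjt⟩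
    by_cases h2 : i = j
    · rw [h2, Equiv.swap_apply_right]
      exact ⟨fun _ => hjt, fun _ => ht⟩
    rw [Equiv.swap_apply_of_ne_of_ne h1 h2]
  · show e₀ (σ (Equiv.swap z j z)) = x
    rw [Equiv.swap_apply_left, hj]
    simp

theorem IsExtremal.nonempty_iso {V : Type*} [Fintype V] {G : SimpleGraph V} {x : V} {r t p : ℕ}
    (ht : 1 ≤ t) (htr : t ≤ r) (hcard : Fintype.card V = r + 1 + p)
    (h : IsExtremal G Finset.univ x r t) :
    Nonempty (G ≃g addPendant (cliqueJoin r t) (some ⟨0, by omega⟩) p) := by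
  classical
  obtain ⟨Q, v, -, -, hvQ, hxQ, hr, hQ, hdeg, hvx, hP⟩ := h
  have hr' : Q.card = r := by exact_mod_cast hr
  have hcount : Nat.card {a : Q // G.Adj v a} = t := by
    rw [degIn_eq_card_filter] at hdeg
    have h1 : (Q.filter (G.Adj v)).card = t := by exact_mod_cast hdeg
    rw [Nat.card_eq_fintype_card, Fintype.card_subtype, ← h1, ← Finset.card_map
      (Function.Embedding.subtype _)]
    congr 1
    ext w
    simp [and_comm]
  obtain ⟨e, he, hex⟩ := exists_equiv_of_filter ht htr (Finset.equivFinOfCardEq hr').symm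
    (fun a : Q => G.Adj v a) hcount (x := ⟨x, hxQ⟩) hvx
  set R := (insert v Q)ᶜ with hR
  have hRcard : R.card = p := by
    rw [hR, Finset.card_compl, Finset.card_insert_of_notMem hvQ, hr', hcard]; omega
  let g := (Finset.equivFinOfCardEq hRcard).symm
  have hgR : ∀ k, (g k : V) ∉ Q ∧ (g k : V) ≠ v := by
    intro k
    have := Finset.mem_compl.1 (g k).2
    rw [Finset.mem_insert, not_or] at this
    exact ⟨this.2, this.1⟩
  obtain ⟨φ, hφs, hφn, hφr⟩ : ∃ φ : Option (Fin r) ⊕ Fin p → V,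
      (∀ i, φ (.inl (some i)) = e i) ∧ φ (.inl none) = v ∧ ∀ k, φ (.inr k) = g k :=
    ⟨fun a => match a with
      | .inl (some i) => e i
      | .inl none => v
      | .inr k => g k, fun _ => rfl, rfl, fun _ => rfl⟩
  have heQ : ∀ i, (e i : V) ∈ Q := fun i => (e i).2
  have hinj : Function.Injective φ := by
    rintro ((_ | i) | k) ((_ | j) | l) hab <;> simp only [hφs, hφn, hφr] at hab
    · rfl
    · exact absurd (hab ▸ heQ j) hvQ
    · exact absurd hab.symm (hgR l).2
    · exact absurd (hab ▸ heQ i) hvQ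
    · rw [e.injective (Subtype.ext hab)]
    · exact absurd (hab ▸ heQ i) (hgR l).1
    · exact absurd hab (hgR k).2
    · exact absurd (hab.symm ▸ heQ j) (hgR k).1
    · rw [g.injective (Subtype.ext hab)]
  have hbij : Function.Bijective φ :=
    (Fintype.bijective_iff_injective_and_card φ).2 ⟨hinj, by simp [hcard]⟩
  have hφx : φ (Sum.inl (some ⟨0, by omega⟩)) = x := by
    rw [hφs, hex]
  have hpend : ∀ k a, G.Adj (φ (Sum.inr k)) (φ a) ↔ a = Sum.inl (some ⟨0, by omega⟩) := by
    intro k a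
    rw [hφr, hP _ (Finset.mem_univ _) (hgR k).1 (hgR k).2 _ (Finset.mem_univ _), ← hφx]
    exact hinj.eq_iff
  refine ⟨RelIso.symm ⟨Equiv.ofBijective φ hbij, ?_⟩⟩
  intro a b
  show G.Adj (φ a) (φ b) ↔ _
  rcases a with (_ | i) | k <;> rcases b with (_ | j) | l
  · exact ⟨fun h => h.ne rfl, fun h => h.elim⟩
  · rw [hφn, hφs]; exact he j
  · rw [G.adj_comm, hpend]; exact Sum.inl_injective.eq_iff
  · rw [hφn, hφs, G.adj_comm]; exact he i
  · rw [hφs, hφs]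
    refine ⟨fun h hij => h.ne (by rw [hij]), fun h => ?_⟩
    exact hQ _ (heQ i) _ (heQ j) fun e' => h (e.injective (Subtype.ext e'))
  · rw [G.adj_comm, hpend]; exact Sum.inl_injective.eq_iff
  · rw [hpend]; exact Sum.inl_injective.eq_iff
  · rw [hpend]; exact Sum.inl_injective.eq_iff
  · rw [hpend]; exact ⟨fun h => (Sum.inr_ne_inl h).elim, fun h => h.elim⟩

open Classical in
theorem degree_cliqueJoin_zero {r t : ℕ} (ht : 1 ≤ t) (htr : t ≤ r) :
    (cliqueJoin r t).degree (some ⟨0, by omega⟩) = r := by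
  have h : (cliqueJoin r t).neighborFinset (some ⟨0, by omega⟩) =
      Finset.univ.erase (some ⟨0, by omega⟩) := by
    ext w
    rw [SimpleGraph.mem_neighborFinset, Finset.mem_erase]
    exact ⟨fun h => ⟨h.ne.symm, Finset.mem_univ _⟩, fun h =>
      (isExtremal_cliqueJoin ht htr).adj w (Finset.mem_univ _) h.1⟩
  rw [← SimpleGraph.card_neighborFinset_eq_degree, h,
    Finset.card_erase_of_mem (Finset.mem_univ _)]
  simp

theorem IsExtremal.isCliqueWithPendants {n r t : ℕ} {G : SimpleGraph (Fin n)} {x : Fin n}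
    (ht : 1 ≤ t) (htr : t ≤ r) (hrn : r + 1 ≤ n) (h : IsExtremal G Finset.univ x r t) :
    IsCliqueWithPendants n r t G :=
  ⟨_, degree_cliqueJoin_zero ht htr, h.nonempty_iso ht htr (by simp; omega)⟩

end Isomorphism

/-! ### The parameters r and t in terms of the cyclomatic number -/

theorem two_mul_choose_two (k : ℕ) : 2 * (k.choose 2 : ℤ) = k * (k - 1) := by
  induction k with
  | zero => simp
  | succ k ih =>
    rw [Nat.choose_succ_succ' k 1, Nat.choose_one_right]
    push_cast
    linarith

theorem IsParams.cycleParams {m n r t : ℕ} (h : IsParams m n r t) (hmn : n ≤ m + 1) :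
    1 ≤ t ∧ t ≤ r ∧ CycleParams ((m : ℤ) - n + 1) r t := by
  obtain ⟨hr, ht, he, hg, htree⟩ := h
  by_cases hc : n ≤ m
  · obtain ⟨h2, h3⟩ := hg hc
    refine ⟨ht, h3, Or.inr ⟨by omega, by omega, ?_⟩⟩
    have := two_mul_choose_two (r - 1)
    rw [Nat.cast_sub hr] at this
    push_cast at this
    linarith
  · obtain ⟨rfl, rfl⟩ := htree (by omega)
    exact ⟨le_rfl, le_rfl, Or.inl ⟨by omega, rfl, rfl⟩⟩

/-- If r ≥ n and t ≥ 2, the cyclomatic number exceeds C(n-1,2), its value for the complete graph. -/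
theorem IsParams.add_one_le {m n r t : ℕ} (h : IsParams m n r t) (hm : 0 < m) (hn : 0 < n)
    (hmn : n ≤ m + 1) (hupp : m ≤ n.choose 2) : r + 1 ≤ n := by
  obtain ⟨ht, htr, hc⟩ := h.cycleParams hmn
  have h2 : 2 ≤ n := by
    by_contra hlt
    have : n = 1 := by omega
    subst this
    simp at hupp
    omega
  have h3 := two_mul_choose_two n
  have h4 : (m : ℤ) ≤ n.choose 2 := by exact_mod_cast hupp
  rcases hc with ⟨-, hr, -⟩ | ⟨h5, h6, h7⟩
  · omega
  · by_contra hlt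
    have h8 : (n : ℤ) ≤ r := by omega
    have h9 : (2 : ℤ) ≤ n := by exact_mod_cast h2
    nlinarith

/-! ### Comparison in the S-order -/

section Main

variable {m n r t : ℕ}

theorem walks2_of_mem {G : SimpleGraph (Fin n)} (hG : G ∈ connectedGraphs m n) :
    walks2 G Finset.univ = 2 * m := by
  rw [walks2_univ_eq, hG.2]

theorem IsExtremal.mem_connectedGraphs {G : SimpleGraph (Fin n)} {x : Fin n} {r t : ℤ}
    (hc : CycleParams ((m : ℤ) - n + 1) r t) (h : IsExtremal G Finset.univ x r t) :
    G ∈ connectedGraphs m n := by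
  refine ⟨h.connected, ?_⟩
  have h1 := h.walks.1
  rw [walks2_univ_eq, Finset.card_univ, Fintype.card_fin] at h1
  have : (G.edgeSet.ncard : ℤ) = m := by
    rcases hc with ⟨h2, rfl, rfl⟩ | ⟨-, -, h2⟩ <;> linarith
  exact_mod_cast this

/-- The triangle bound for the whole vertex set. The size conditions ensure that the deciding moment
has index at most n - 1, except when (m,n) = (3,4). -/
theorem extremal_or_walks_lt (hn : 2 ≤ n) {r t : ℤ} (hc : CycleParams ((m : ℤ) - n + 1) r t)
    {G H : SimpleGraph (Fin n)} {x : Fin n} (hG : IsExtremal G Finset.univ x r t)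
    (hH : H ∈ connectedGraphs m n) :
    (∃ y, IsExtremal H Finset.univ y r t) ∨
      (walks3 H Finset.univ < walks3 G Finset.univ ∧ 4 ≤ n) ∨
      (walks3 H Finset.univ = walks3 G Finset.univ ∧ walks4 H Finset.univ < walks4 G Finset.univ ∧
        4 ≤ n ∧ (n = 4 → m = 3)) := by
  have hcard : (Finset.univ : Finset (Fin n)).card = n := by simp
  obtain ⟨c, hc0, hw2, hw3, heq⟩ := triangleBound n Finset.univ hcard hn (connOn_univ hH.1)
  obtain ⟨-, g3, g4⟩ := hG.walks
  have h2 := walks2_of_mem hH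
  rw [hcard] at hw2
  obtain rfl : c = (m : ℤ) - n + 1 := by omega
  rw [← hc.triMax_eq] at g3
  rcases hw3.lt_or_eq with hlt | he
  · refine Or.inr (Or.inl ⟨by rw [g3]; exact hlt, ?_⟩)
    -- With at most three vertices the only connected graphs are trees and the triangle, and both
    -- attain the bound.
    by_contra h4
    have hle := walks2_le (G := H) Finset.univ
    rw [hcard] at hle
    have hw0 : 0 ≤ walks3 H Finset.univ :=
      Finset.sum_nonneg fun _ _ => Finset.sum_nonneg fun _ _ => Finset.sum_nonneg fun _ _ =>
        mul_nonneg (mul_nonneg (adjInd_nonneg _ _) (adjInd_nonneg _ _)) (adjInd_nonneg _ _)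
    have hn' : n = 2 ∨ n = 3 := by omega
    rcases hn' with rfl | rfl
    · have : (m : ℤ) - (2 : ℕ) + 1 = 0 := by push_cast at *; omega
      rw [this, triMax_zero] at hlt
      omega
    · have : (m : ℤ) - (3 : ℕ) + 1 = 0 ∨ (m : ℤ) - (3 : ℕ) + 1 = 1 := by push_cast at *; omega
      rcases this with e | e
      · rw [e, triMax_zero] at hlt
        omega
      · rw [e, triMax_one] at hlt
        have hcl : CliqueOn H Finset.univ := cliqueOn_of_walks2 (by
          rw [hcard, h2]; push_cast at *; omega)
        rw [hcl.walks3_eq, hcard] at hlt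
        norm_num at hlt
  · rcases (heq he).2 r t hc with h | ⟨h1, h3, h5⟩
    · exact Or.inl h
    · rw [hcard] at h1 h3 h5
      rw [hcard] at g4
      refine Or.inr (Or.inr ⟨by rw [g3, he], by rw [g4]; exact h1, h3, fun h => ?_⟩)
      have := h5 h
      omega

theorem spectralMoment_eq_of_lt_three {G H : SimpleGraph (Fin n)} (hG : G ∈ connectedGraphs m n)
    (hH : H ∈ connectedGraphs m n) {i : ℕ} (hi : i < 3) :
    spectralMoment G i = spectralMoment H i := by
  interval_cases i
  · rw [spectralMoment_zero, spectralMoment_zero]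
  · rw [spectralMoment_one, spectralMoment_one]
  · rw [spectralMoment_two, spectralMoment_two, walks2_of_mem hG, walks2_of_mem hH]

theorem IsExtremal.nonempty_iso_of_isExtremal (ht : 1 ≤ t) (htr : t ≤ r) (hrn : r + 1 ≤ n)
    {G H : SimpleGraph (Fin n)} {x y : Fin n} (hG : IsExtremal G Finset.univ x r t)
    (hH : IsExtremal H Finset.univ y r t) : Nonempty (H ≃g G) := by
  obtain ⟨e⟩ := hG.nonempty_iso (p := n - r - 1) ht htr (by simp; omega)
  obtain ⟨f⟩ := hH.nonempty_iso (p := n - r - 1) ht htr (by simp; omega)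
  exact ⟨f.trans e.symm⟩

/-- A competitor is isomorphic, hence has the same moments, or its first difference is a smaller S_3
or S_4. -/
theorem IsExtremal.not_sBefore (ht : 1 ≤ t) (htr : t ≤ r) (hrn : r + 1 ≤ n)
    (hc : CycleParams ((m : ℤ) - n + 1) r t) {G H : SimpleGraph (Fin n)} {x : Fin n}
    (hG : IsExtremal G Finset.univ x r t) (hH : H ∈ connectedGraphs m n) : ¬ SBefore G H := by
  rintro ⟨j, -, -, hlow, hj⟩
  have hlt := fun {i} => spectralMoment_eq_of_lt_three (hG.mem_connectedGraphs hc) hH (i := i)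
  have hj3 : 3 ≤ j := by
    by_contra h
    exact hj.ne (hlt (by omega))
  rcases extremal_or_walks_lt (by omega) hc hG hH with ⟨y, h⟩ | ⟨h, -⟩ | ⟨h3, h4, -⟩
  · obtain ⟨e⟩ := hG.nonempty_iso_of_isExtremal ht htr hrn h
    exact hj.ne (spectralMoment_congr e j).symm
  · have h' : spectralMoment H 3 < spectralMoment G 3 := by
      rw [spectralMoment_three, spectralMoment_three]; exact_mod_cast h
    rcases hj3.eq_or_lt with rfl | h5
    · exact lt_asymm hj h'
    · exact h'.ne (hlow 3 h5).symm
  · have e3 : spectralMoment H 3 = spectralMoment G 3 := by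
      rw [spectralMoment_three, spectralMoment_three, h3]
    have h' : spectralMoment H 4 < spectralMoment G 4 := by
      rw [spectralMoment_four, spectralMoment_four]; exact_mod_cast h4
    rcases hj3.eq_or_lt with rfl | h5
    · exact hj.ne e3.symm
    rcases (show 4 ≤ j from h5).eq_or_lt with rfl | h6
    · exact lt_asymm hj h'
    · exact h'.ne (hlow 4 h6).symm

theorem IsExtremal.extremal_or_sBefore (hn : 2 ≤ n) {r t : ℤ}
    (hc : CycleParams ((m : ℤ) - n + 1) r t) (hex : ¬ (m = 3 ∧ n = 4))
    {G H : SimpleGraph (Fin n)} {x : Fin n} (hG : IsExtremal G Finset.univ x r t)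
    (hH : H ∈ connectedGraphs m n) :
    (∃ y, IsExtremal H Finset.univ y r t) ∨ SBefore H G := by
  have hlt := fun {i} => spectralMoment_eq_of_lt_three hH (hG.mem_connectedGraphs hc) (i := i)
  rcases extremal_or_walks_lt hn hc hG hH with h | ⟨h, h4⟩ | ⟨h3, h4, h5, h6⟩
  · exact Or.inl h
  · refine Or.inr ⟨3, by norm_num, by omega, fun i hi => hlt hi, ?_⟩
    rw [spectralMoment_three, spectralMoment_three]
    exact_mod_cast h
  · refine Or.inr ⟨4, by norm_num, by omega, fun i hi => ?_, ?_⟩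
    · rcases (show i ≤ 3 by omega).lt_or_eq with h | rfl
      · exact hlt h
      · rw [spectralMoment_three, spectralMoment_three, h3]
    · rw [spectralMoment_four, spectralMoment_four]
      exact_mod_cast h4

theorem exists_isCliqueWithPendants (ht : 1 ≤ t) (htr : t ≤ r) (hrn : r + 1 ≤ n) :
    ∃ G : SimpleGraph (Fin n), IsCliqueWithPendants n r t G := by
  have e : Fin n ≃ Option (Fin r) ⊕ Fin (n - r - 1) :=
    Fintype.equivOfCardEq (by simp; omega)
  exact ⟨(addPendant (cliqueJoin r t) (some ⟨0, by omega⟩) (n - r - 1)).comap e,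
    _, degree_cliqueJoin_zero ht htr, ⟨SimpleGraph.Iso.comap e _⟩⟩

end Main

end SOrder

theorem theorem105 (m n r t : ℕ) (hm : 0 < m) (hn : 0 < n)
    (hlow : n - 1 ≤ m) (hupp : m ≤ n.choose 2) (hrt : SOrder.IsParams m n r t) :
    (∃ G : SimpleGraph (Fin n), SOrder.IsCliqueWithPendants n r t G) ∧
    (∀ G : SimpleGraph (Fin n), SOrder.IsCliqueWithPendants n r t G → SOrder.IsLast m n G) ∧
    (¬ (m = 3 ∧ n = 4) →
      (∀ G : SimpleGraph (Fin n), SOrder.IsLast m n G → SOrder.IsCliqueWithPendants n r t G) ∧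
      (∀ G : SimpleGraph (Fin n), SOrder.IsLast m n G →
        ∀ H ∈ SOrder.connectedGraphs m n, Nonempty (H ≃g G) ∨ SOrder.SBefore H G)) := by
  have hmn : n ≤ m + 1 := by omega
  obtain ⟨ht, htr, hc⟩ := hrt.cycleParams hmn
  have hrn := hrt.add_one_le hm hn hmn hupp
  have hn2 : 2 ≤ n := by omega
  obtain ⟨G₀, hG₀⟩ := SOrder.exists_isCliqueWithPendants ht htr hrn
  obtain ⟨x₀, hx₀⟩ := hG₀.isExtremal ht htr
  -- A last graph is compared with `G₀`: were it not extremal, it would come before `G₀`.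
  have hlast : ¬ (m = 3 ∧ n = 4) → ∀ G : SimpleGraph (Fin n), SOrder.IsLast m n G →
      ∃ x, SOrder.IsExtremal G Finset.univ x r t := fun hex G hG =>
    (hx₀.extremal_or_sBefore hn2 hc hex hG.1).resolve_right
      (hG.2 G₀ (hx₀.mem_connectedGraphs hc))
  refine ⟨⟨G₀, hG₀⟩, fun G hG => ?_, fun hex => ⟨fun G hG => ?_, fun G hG H hH => ?_⟩⟩
  · obtain ⟨x, hx⟩ := hG.isExtremal ht htr
    exact ⟨hx.mem_connectedGraphs hc, fun H hH => hx.not_sBefore ht htr hrn hc hH⟩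
  · obtain ⟨x, hx⟩ := hlast hex G hG
    exact hx.isCliqueWithPendants ht htr hrn
  · obtain ⟨x, hx⟩ := hlast hex G hG
    rcases hx.extremal_or_sBefore hn2 hc hex hH with ⟨y, hy⟩ | h
    · exact Or.inl (hx.nonempty_iso_of_isExtremal ht htr hrn hy)
    · exact Or.inr h
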